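/- Let $N\ge 0$, $m\ge 1$ be integers and $\mathbb T^N=\mathbb R^N/\mathbb Z^N$. For $i=1,\dots,m$ let $H_i:\mathbb T^N\times\mathbb R^N\to\mathbb R$ be continuous, convex in the second variable, and such that $\alpha_i(|p|)\le H_i(x,p)\le\beta_i(|p|)$ for all $(x,p)$, for some functions $\alpha_i,\beta_i:[0,+\infty)\to\mathbb R$ tending to $+\infty$ at $+\infty$. Let $B(x)=(b_{ij}(x))$ be an $m\times m$ real matrix depending continuously on $x\in\mathbb T^N$ such that, for every $x$: $b_{ij}(x)\le 0$ for $j\ne i$; $\sum_{j}b_{ij}(x)=0$ for every $i$; and $B(x)$ is irreducible, i.e. for every nonempty $\mathcal I\subsetneq\{1,\dots,m\}$ there are $i\in\mathcal I$, $j\notin\mathcal I$ with $b_{ij}(x)\ne 0$. For $a\in\mathbb R$ consider the weakly coupled system $$H_i(x,Du_i)+\sum_{j=1}^m b_{ij}(x)u_j(x)=a\quad\text{in }\mathbb T^N,\qquad i=1,\dots,m. \tag{$S_a$}$$ For a continuous $w:\mathbb T^N\to\mathbb R$, let $D^+w(x)$ (resp. $D^-w(x)$) be the set of gradients $D\varphi(x)$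 of functions $\varphi$ of class $C^1$ near $x$ such that $w-\varphi$ has a local maximum (resp. minimum) at $x$. A continuous $\mathbf u=(u_1,\dots,u_m):\mathbb T^N\to\mathbb R^m$ is a viscosity subsolution (resp. supersolution) of $(S_a)$ if for all $x\in\mathbb T^N$ and all $i$ one has $H_i(x,p)+\sum_j b_{ij}(x)u_j(x)\le a$ for every $p\in D^+u_i(x)$ (resp. $\ge a$ for every $p\in D^-u_i(x)$), and a viscosity solution if it is both. Let $\mathcal H(a)$ be the set of viscosity subsolutions of $(S_a)$ and let $$c=\inf\{a\in\mathbb R:\mathcal H(a)\ne\varnothing\}.$$ Then $c$ is finite and the infimum is attained, i.e. $c$ is the least $a$ with $\mathcal H(a)\ne\varnothing$; there exists $\mathbf u\in\mathcal H(c)$ which is a viscosity solution of $(S_c)$; and $(S_a)$ has a viscosity solution if and only if $a=c$. -/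

import Mathlib

open Filter Topology
open scoped NNReal

namespace WeakKAM

/-- The flat torus `ℝ^N / ℤ^N`. -/
abbrev Torus (N : ℕ) : Type := UnitAddTorus (Fin N)

/-- The space `ℝ^N` with the Euclidean norm. -/
abbrev Space (N : ℕ) : Type := EuclideanSpace ℝ (Fin N)

/-- The canonical projection `ℝ^N → ℝ^N / ℤ^N`. -/
def proj {N : ℕ} (y : Space N) : Torus N := fun k => (y k : UnitAddCircle)

/-- The set `D⁺u(x)` of superdifferentials of `u` at `x`: the gradients at `x` of the `C¹` functions
`φ` defined near `x` such that `u - φ` has a local maximum at `x`. A function near a point of the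
torus is read near a lift `y` of the point to `ℝ^N`; the choice of the lift is immaterial. -/
def superdifferential {N : ℕ} (u : Torus N → ℝ) (x : Torus N) : Set (Space N) :=
  {p | ∃ y : Space N, proj y = x ∧ ∃ φ : Space N → ℝ,
    ContDiffAt ℝ 1 φ y ∧ IsLocalMax (fun z => u (proj z) - φ z) y ∧ HasGradientAt φ p y}

/-- The set `D⁻u(x)` of subdifferentials of `u` at `x`. -/
def subdifferential {N : ℕ} (u : Torus N → ℝ) (x : Torus N) : Set (Space N) :=
  {p | ∃ y : Space N, proj y = x ∧ ∃ φ : Space N → ℝ,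
    ContDiffAt ℝ 1 φ y ∧ IsLocalMin (fun z => u (proj z) - φ z) y ∧ HasGradientAt φ p y}

/-- Convex Hamiltonians: continuous on `𝕋^N × ℝ^N`, convex in the momentum, and bounded from below
and from above by coercive functions of the norm of the momentum. -/
structure IsConvexHamiltonian {N : ℕ} (H : Torus N → Space N → ℝ) : Prop where
  continuous : Continuous (Function.uncurry H)
  convex : ∀ x, ConvexOn ℝ Set.univ (H x)
  coercive : ∃ α β : ℝ≥0 → ℝ, Tendsto α atTop atTop ∧ Tendsto β atTop atTop ∧
    ∀ x p, α ‖p‖₊ ≤ H x p ∧ H x p ≤ β ‖p‖₊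

/-- Coupling matrices: nonpositive off the diagonal, with nonnegative row sums. -/
structure IsCoupling {m : ℕ} (B : Matrix (Fin m) (Fin m) ℝ) : Prop where
  off_diag_nonpos : ∀ i j, j ≠ i → B i j ≤ 0
  row_sum_nonneg : ∀ i, 0 ≤ ∑ j, B i j

/-- Degenerate matrices: all the row sums vanish. -/
def IsDegenerate {m : ℕ} (B : Matrix (Fin m) (Fin m) ℝ) : Prop :=
  ∀ i, ∑ j, B i j = 0

/-- Irreducible matrices. -/
def IsIrreducible {m : ℕ} (B : Matrix (Fin m) (Fin m) ℝ) : Prop :=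
  ∀ I : Set (Fin m), I.Nonempty → I ≠ Set.univ → ∃ i ∈ I, ∃ j ∉ I, B i j ≠ 0

/-- The `i`-th component of `B(x) u(x)`. -/
def couplingTerm {N m : ℕ} (B : Torus N → Matrix (Fin m) (Fin m) ℝ)
    (u : Fin m → C(Torus N, ℝ)) (x : Torus N) (i : Fin m) : ℝ :=
  ∑ j, B x i j * u j x

/-- Continuous viscosity subsolutions of `H_i(x, Du_i) + (B(x)u(x))_i = a_i` in `𝕋^N`, for all `i`. -/
def IsSubsolution {N m : ℕ} (H : Fin m → Torus N → Space N → ℝ)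
    (B : Torus N → Matrix (Fin m) (Fin m) ℝ) (a : Fin m → ℝ) (u : Fin m → C(Torus N, ℝ)) : Prop :=
  ∀ (x : Torus N) (i : Fin m), ∀ p ∈ superdifferential (u i) x,
    H i x p + couplingTerm B u x i ≤ a i

/-- Continuous viscosity supersolutions of `H_i(x, Du_i) + (B(x)u(x))_i = a_i` in `𝕋^N`, for all
`i`. -/
def IsSupersolution {N m : ℕ} (H : Fin m → Torus N → Space N → ℝ)
    (B : Torus N → Matrix (Fin m) (Fin m) ℝ) (a : Fin m → ℝ) (u : Fin m → C(Torus N, ℝ)) : Prop :=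
  ∀ (x : Torus N) (i : Fin m), ∀ p ∈ subdifferential (u i) x,
    a i ≤ H i x p + couplingTerm B u x i

/-- Continuous viscosity solutions: both sub- and supersolutions. -/
def IsSolution {N m : ℕ} (H : Fin m → Torus N → Space N → ℝ)
    (B : Torus N → Matrix (Fin m) (Fin m) ℝ) (a : Fin m → ℝ) (u : Fin m → C(Torus N, ℝ)) : Prop :=
  IsSubsolution H B a u ∧ IsSupersolution H B a u

/-- The set of the subsolutions of the system with right-hand side `(a, …, a)`. -/
def subsolutions {N m : ℕ} (H : Fin m → Torus N → Space N → ℝ)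
    (B : Torus N → Matrix (Fin m) (Fin m) ℝ) (a : ℝ) : Set (Fin m → C(Torus N, ℝ)) :=
  {u | IsSubsolution H B (fun _ => a) u}

/-- The critical value: the infimum of the `a` for which there are subsolutions. -/
noncomputable def criticalValue {N m : ℕ} (H : Fin m → Torus N → Space N → ℝ)
    (B : Torus N → Matrix (Fin m) (Fin m) ℝ) : ℝ :=
  sInf {a : ℝ | (subsolutions H B a).Nonempty}

end WeakKAM

namespace WeakKAM

variable {N m : ℕ}

open scoped RealInnerProductSpace

/-! ### The projection onto the torus -/

/-! A pair `(c, u)` solving the system is obtained as a vanishing discount limit, and a comparison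
of right-hand sides then identifies `c`. If `v` is a subsolution for `a` and `u` a supersolution for
`a'`, then `a' ≤ a` (`SystemSub.le_of_systemSuper`). Variables are doubled and `v_i - u_i` is
maximized over the component as well. Coercivity bounds the gradients, so in the limit both
inequalities share one point and one momentum and the Hamiltonians cancel. At a component maximizing
`v - u`, the coupling applied to `v - u` is nonnegative because its row sums vanish. Hence a
solution for `c` makes `c` the least admissible value and the only one with a solution. To produce a
solution, add a discount term `l u_i` with `l > 0`. Coercivity makes bounded families of
subsolutions equi-Lipschitz, hence compact, so a maximal subsolution exists; by Perron's bump
argument it is a supersolution. Here `l u` is bounded uniformly in `l`. Irreducibility, made uniform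
by compactness (`exists_oscillation_bound`), bounds the differences between components, and the
Lipschitz estimate bounds the oscillation in space. Constants are in the kernel of the coupling, so
subtracting one value of `u` leaves a bounded family with bounded right-hand sides; stability passes
to the limit `l → 0`. All of this is done with global paraboloids on lifts as test functions
(`quadSub_iff`). -/

theorem isOpenQuotientMap_proj : IsOpenQuotientMap (proj : Space N → Torus N) := by
  have h : IsOpenQuotientMap
      (Pi.map (fun _ : Fin N => ((↑) : ℝ → UnitAddCircle))) :=
    IsOpenQuotientMap.piMap fun _ => QuotientAddGroup.isOpenQuotientMap_mk
  exact h.comp (EuclideanSpace.equiv (Fin N) ℝ).toHomeomorph.isOpenQuotientMap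

theorem continuous_proj : Continuous (proj : Space N → Torus N) :=
  isOpenQuotientMap_proj.continuous

theorem proj_surjective : Function.Surjective (proj : Space N → Torus N) :=
  isOpenQuotientMap_proj.surjective

theorem proj_add (y z : Space N) : proj (y + z) = proj y + proj z := by
  funext k; simp [proj]

theorem proj_sub (y z : Space N) : proj (y - z) = proj y - proj z := by
  funext k; simp [proj]

theorem proj_zero : proj (0 : Space N) = 0 := by
  funext k; simp [proj]

/-- The points of the torus have lifts of bounded norm. -/
theorem exists_bounded_lift (N : ℕ) :
    ∃ R : ℝ, 0 ≤ R ∧ ∀ x : Torus N, ∃ y : Space N, proj y = x ∧ ‖y‖ ≤ R := by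
  obtain ⟨n, hn⟩ := (isCompact_univ (X := Torus N)).elim_directed_cover
    (fun n : ℕ => proj '' Metric.ball (0 : Space N) n)
    (fun n => isOpenQuotientMap_proj.isOpenMap _ Metric.isOpen_ball)
    (fun x _ => by
      obtain ⟨y, rfl⟩ := proj_surjective x
      obtain ⟨n, hn⟩ := exists_nat_gt ‖y‖
      exact Set.mem_iUnion.2 ⟨n, y, by simpa using hn, rfl⟩)
    (directed_of_isDirected_le fun a b hab =>
      Set.image_mono (Metric.ball_subset_ball (by exact_mod_cast hab)))
  refine ⟨n, n.cast_nonneg, fun x => ?_⟩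
  obtain ⟨y, hy, rfl⟩ := hn (Set.mem_univ x)
  exact ⟨y, rfl, (mem_ball_zero_iff.1 hy).le⟩

/-! ### Maxima of functions with a coercive penalization -/

/-- A continuous function dominated by a negative multiple of the norm attains its maximum on a
closed set. -/
theorem exists_max_of_le_sub_norm {E : Type*} [NormedAddCommGroup E] [ProperSpace E] {s : Set E}
    (hs : IsClosed s) (hne : s.Nonempty) {F : E → ℝ} (hF : Continuous F) {C K : ℝ} (hK : 0 < K)
    (y : E) (hle : ∀ z, F z ≤ C - K * ‖z - y‖) : ∃ w ∈ s, ∀ z ∈ s, F z ≤ F w := by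
  obtain ⟨x₀, hx₀⟩ := hne
  have htend : Tendsto F (cocompact E) atBot := by
    refine tendsto_atBot_mono (f := fun z : E => (C + K * ‖y‖) - K * ‖z‖) (fun z => ?_) ?_
    · have := norm_sub_norm_le z y
      nlinarith [hle z]
    · exact tendsto_atBot_add_const_left _ _
        (tendsto_neg_atTop_atBot.comp
          ((tendsto_norm_cocompact_atTop (E := E)).const_mul_atTop hK))
  obtain ⟨w, hw, hmax⟩ := hF.continuousOn.exists_isMaxOn' hs hx₀
    ((htend.eventually_le_atBot (F x₀)).filter_mono inf_le_left)
  exact ⟨w, hw, fun z hz => hmax hz⟩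

/-- Bounds of a continuous function on the torus. -/
theorem le_norm_apply (u : C(Torus N, ℝ)) (x : Torus N) : |u x| ≤ ‖u‖ :=
  u.norm_coe_le_norm x

/-- A quadratically penalized continuous function on the torus attains its maximum on closed sets
of lifts. -/
theorem exists_max_sub_quadratic (u : C(Torus N, ℝ)) {s : Set (Space N)} (hs : IsClosed s)
    (hne : s.Nonempty) (y p : Space N) {A : ℝ} (hA : 0 < A) :
    ∃ w ∈ s, ∀ z ∈ s, u (proj z) - (⟪p, z - y⟫ + A * ‖z - y‖ ^ 2) ≤
      u (proj w) - (⟪p, w - y⟫ + A * ‖w - y‖ ^ 2) := by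
  -- The constant comes from completing the square: `(‖p‖ + 1) t - A t²` is at most `(‖p‖ + 1)² /
  -- (4A)`, leaving linear decay of slope 1.
  refine exists_max_of_le_sub_norm (K := 1) (C := ‖u‖ + (‖p‖ + 1) ^ 2 / (4 * A)) hs hne
    (F := fun z => u (proj z) - (⟪p, z - y⟫ + A * ‖z - y‖ ^ 2)) ?_ one_pos y fun z => ?_
  · have := continuous_proj (N := N)
    fun_prop
  · have h1 := (abs_le.1 (le_norm_apply u (proj z))).2
    have h2 := (abs_le.1 (abs_real_inner_le_norm p (z - y))).1
    have h3 : (‖p‖ + 1) * ‖z - y‖ ≤ A * ‖z - y‖ ^ 2 + (‖p‖ + 1) ^ 2 / (4 * A) := by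
      have : A * ‖z - y‖ ^ 2 + (‖p‖ + 1) ^ 2 / (4 * A) - (‖p‖ + 1) * ‖z - y‖ =
        (2 * A * ‖z - y‖ - (‖p‖ + 1)) ^ 2 / (4 * A) := by field_simp; ring
      have : 0 ≤ (2 * A * ‖z - y‖ - (‖p‖ + 1)) ^ 2 / (4 * A) := by positivity
      linarith
    linarith

/-- A quadratic polynomial expanded at another point. -/
theorem quadratic_recenter (p y w z : Space N) (A : ℝ) :
    ⟪p, z - y⟫ + A * ‖z - y‖ ^ 2 = ⟪p, w - y⟫ + A * ‖w - y‖ ^ 2 +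
      (⟪p + (2 * A) • (w - y), z - w⟫ + A * ‖z - w‖ ^ 2) := by
  have h : z - y = (w - y) + (z - w) := by abel
  rw [h, norm_add_sq_real, inner_add_right, inner_add_left, inner_smul_left]
  simp only [conj_trivial]
  ring

/-! ### Quadratic test functions -/

/-- `u` satisfies `H(x, Du) + g ≤ 0` when tested from above with paraboloids. -/
def QuadSub (H : Torus N → Space N → ℝ) (u g : C(Torus N, ℝ)) : Prop :=
  ∀ (y p : Space N) (A : ℝ), 0 ≤ A →
    (∀ z, u (proj z) ≤ u (proj y) + (⟪p, z - y⟫ + A * ‖z - y‖ ^ 2)) →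
    H (proj y) p + g (proj y) ≤ 0

/-- `u` satisfies `H(x, Du) + g ≥ 0` when tested from below with paraboloids. -/
def QuadSuper (H : Torus N → Space N → ℝ) (u g : C(Torus N, ℝ)) : Prop :=
  QuadSub (fun x p => -H x (-p)) (-u) (-g)

/-- A local paraboloid from above is a global one, with another opening. -/
theorem exists_global_quadratic (u : C(Torus N, ℝ)) {y p : Space N} {A r : ℝ} (hA : 0 ≤ A)
    (hr : 0 < r)
    (h : ∀ z, ‖z - y‖ ≤ r → u (proj z) ≤ u (proj y) + (⟪p, z - y⟫ + A * ‖z - y‖ ^ 2)) :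
    ∃ A' : ℝ, 0 ≤ A' ∧
      ∀ z, u (proj z) ≤ u (proj y) + (⟪p, z - y⟫ + A' * ‖z - y‖ ^ 2) := by
  -- Outside the ball, `‖p‖ / r` absorbs the linear term and `2‖u‖ / r²` the oscillation of `u`.
  refine ⟨A + ‖p‖ / r + 2 * ‖u‖ / r ^ 2, by positivity, fun z => ?_⟩
  have e1 : 0 ≤ ‖p‖ / r * ‖z - y‖ ^ 2 := by positivity
  have e2 : 0 ≤ 2 * ‖u‖ / r ^ 2 * ‖z - y‖ ^ 2 := by positivity
  have e3 : 0 ≤ A * ‖z - y‖ ^ 2 := by positivity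
  rcases le_or_gt ‖z - y‖ r with hz | hz
  · have := h z hz
    linarith
  · have h1 := (abs_le.1 (le_norm_apply u (proj z))).2
    have h1' := (abs_le.1 (le_norm_apply u (proj y))).1
    have h2 := (abs_le.1 (abs_real_inner_le_norm p (z - y))).1
    have h3 : ‖p‖ * ‖z - y‖ ≤ ‖p‖ / r * ‖z - y‖ ^ 2 := by
      have : ‖p‖ / r * ‖z - y‖ ^ 2 - ‖p‖ * ‖z - y‖ = ‖p‖ * ‖z - y‖ / r * (‖z - y‖ - r) := by
        field_simp
      have : 0 ≤ ‖p‖ * ‖z - y‖ / r * (‖z - y‖ - r) :=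
        mul_nonneg (by positivity) (by linarith)
      linarith
    have h4 : 2 * ‖u‖ ≤ 2 * ‖u‖ / r ^ 2 * ‖z - y‖ ^ 2 := by
      rw [div_mul_eq_mul_div, le_div_iff₀ (by positivity)]
      gcongr
    linarith

/-- A point where a superdifferential is not empty is near points with quadratic tests from above
with nearby gradients. -/
theorem exists_quadratic_near (u : C(Torus N, ℝ)) {y p : Space N} {φ : Space N → ℝ}
    (hφ : HasGradientAt φ p y) (hmax : IsLocalMax (fun z => u (proj z) - φ z) y) {ε : ℝ}
    (hε : 0 < ε) : ∃ w q : Space N, ∃ A : ℝ, 0 ≤ A ∧ ‖w - y‖ ≤ ε ∧ ‖q - p‖ ≤ ε ∧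
      ∀ z, u (proj z) ≤ u (proj w) + (⟪q, z - w⟫ + A * ‖z - w‖ ^ 2) := by
  obtain ⟨r, hr, hrε, hball⟩ : ∃ r : ℝ, 0 < r ∧ r ≤ ε ∧ ∀ z, ‖z - y‖ ≤ r →
      u (proj z) ≤ u (proj y) + (⟪p, z - y⟫ + ε / 4 * ‖z - y‖) := by
    have h1 := (hasGradientAt_iff_isLittleO.1 hφ).def (c := ε / 4) (by positivity)
    obtain ⟨r, hr, hball⟩ := Metric.eventually_nhds_iff_ball.1 (h1.and hmax)
    refine ⟨min (r / 2) ε, by positivity, min_le_right _ _, fun z hz => ?_⟩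
    obtain ⟨a, b⟩ := hball z (by
      rw [Metric.mem_ball, dist_eq_norm]
      linarith [min_le_left (r / 2) ε])
    have := (abs_le.1 (by simpa using a : |φ z - φ y - ⟪p, z - y⟫| ≤ _)).2
    linarith
  -- With this opening the penalty beats the error `ε/4 * ‖z - y‖` beyond `r / 2`. The maximum is
  -- therefore interior, and the gradient moves by at most `ε / 2`.
  have hA : 0 < ε / (2 * r) := by positivity
  obtain ⟨w, hw, hwmax⟩ := exists_max_sub_quadratic u (Metric.isClosed_closedBall (x := y) (ε := r))
    ⟨y, by simp [hr.le]⟩ y p hA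
  have hwr : ‖w - y‖ ≤ r := by simpa [dist_eq_norm] using hw
  have hw2 : ‖w - y‖ ≤ r / 2 := by
    have h1 := hwmax y (by simp [hr.le])
    have h2 := hball w hwr
    simp only [sub_self, inner_zero_right, norm_zero] at h1
    have h3 : ε / (2 * r) * ‖w - y‖ ^ 2 ≤ ε / 4 * ‖w - y‖ := by linarith
    by_contra hcon
    push Not at hcon
    have : ε / (2 * r) * ‖w - y‖ ^ 2 - ε / 4 * ‖w - y‖ =
      ε / (2 * r) * ‖w - y‖ * (‖w - y‖ - r / 2) := by field_simp; ring
    have : 0 < ε / (2 * r) * ‖w - y‖ * (‖w - y‖ - r / 2) :=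
      mul_pos (mul_pos hA (by linarith)) (by linarith)
    linarith
  obtain ⟨A', hA', hglob⟩ := exists_global_quadratic u (y := w)
    (p := p + (2 * (ε / (2 * r))) • (w - y)) (A := ε / (2 * r)) (r := r / 2) hA.le (by positivity)
    (fun z hz => by
      have h1 := hwmax z (by
        rw [Metric.mem_closedBall, dist_eq_norm]
        have : z - y = (z - w) + (w - y) := by abel
        rw [this]
        linarith [norm_add_le (z - w) (w - y)])
      have h2 := quadratic_recenter p y w z (ε / (2 * r))
      linarith)
  refine ⟨w, _, A', hA', by linarith, ?_, hglob⟩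
  rw [add_sub_cancel_left, norm_smul, Real.norm_of_nonneg (by positivity)]
  have : 2 * (ε / (2 * r)) * ‖w - y‖ ≤ 2 * (ε / (2 * r)) * (r / 2) := by gcongr
  have h5 : 2 * (ε / (2 * r)) * (r / 2) = ε / 2 := by field_simp
  linarith

theorem hasGradientAt_quadratic (p y : Space N) (A : ℝ) :
    HasGradientAt (fun z => ⟪p, z - y⟫ + A * ‖z - y‖ ^ 2) p y := by
  rw [hasGradientAt_iff_isLittleO]
  simp only [sub_self, inner_zero_right, norm_zero]
  refine (Asymptotics.isLittleO_iff.2 fun c hc => ?_)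
  have hpos : 0 < c / (|A| + 1) := by positivity
  filter_upwards [Metric.ball_mem_nhds y hpos] with z hz
  rw [Metric.mem_ball, dist_eq_norm, lt_div_iff₀ (by positivity)] at hz
  have : ⟪p, z - y⟫ + A * ‖z - y‖ ^ 2 - (0 + A * 0 ^ 2) - ⟪p, z - y⟫ = A * ‖z - y‖ * ‖z - y‖ := by
    ring
  rw [this, norm_mul, norm_mul, norm_norm, Real.norm_eq_abs]
  gcongr
  nlinarith [norm_nonneg (z - y), abs_nonneg A]

/-- Superdifferentials may be tested with paraboloids only. -/
theorem quadSub_iff {H : Torus N → Space N → ℝ} (hH : Continuous (Function.uncurry H))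
    (u g : C(Torus N, ℝ)) :
    QuadSub H u g ↔ ∀ x, ∀ p ∈ superdifferential u x, H x p + g x ≤ 0 := by
  constructor
  · rintro h x p ⟨y, rfl, φ, -, hmax, hφ⟩
    by_contra hcon
    push Not at hcon
    have hcont : Continuous fun q : Space N × Space N => H (proj q.1) q.2 + g (proj q.1) := by
      have h1 := continuous_proj (N := N)
      have h2 : Continuous fun q : Space N × Space N => Function.uncurry H (proj q.1, q.2) := by
        fun_prop
      exact h2.add (by fun_prop)
    obtain ⟨ε, hε, hball⟩ := Metric.eventually_nhds_iff_ball.1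
      (hcont.continuousAt.eventually (lt_mem_nhds (a := 0) (b := H (proj y) p + g (proj y)) hcon) :
        ∀ᶠ q in 𝓝 (y, p), _)
    obtain ⟨w, q, A, hA, hw, hq, htest⟩ := exists_quadratic_near u hφ hmax (half_pos hε)
    have h1 := hball (w, q) (by
      rw [Metric.mem_ball, Prod.dist_eq, max_lt_iff, dist_eq_norm, dist_eq_norm]
      exact ⟨by dsimp only; linarith, by dsimp only; linarith⟩)
    have h2 := h w q A hA htest
    dsimp only at h1
    linarith
  · intro h y p A _ htest
    refine h _ p ⟨y, rfl, fun z => ⟪p, z - y⟫ + A * ‖z - y‖ ^ 2, ?_, ?_,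
      hasGradientAt_quadratic p y A⟩
    · have h1 : ContDiff ℝ 1 fun z : Space N => ⟪p, z - y⟫ + A * ‖z - y‖ ^ 2 :=
        (contDiff_const.inner ℝ (contDiff_id.sub contDiff_const)).add
          (contDiff_const.mul ((contDiff_id.sub contDiff_const).norm_sq ℝ))
      exact h1.contDiffAt
    · refine Eventually.of_forall fun z => ?_
      have := htest z
      simp only [sub_self, inner_zero_right, norm_zero]
      linarith

theorem hasGradientAt_neg {φ : Space N → ℝ} {p y : Space N}
    (h : HasGradientAt φ p y) : HasGradientAt (-φ) (-p) y := by
  rw [hasGradientAt_iff_hasFDerivAt] at h ⊢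
  rw [map_neg]
  exact h.neg

theorem neg_mem_superdifferential_neg {u : Torus N → ℝ} {x : Torus N} {p : Space N} :
    -p ∈ superdifferential (-u) x ↔ p ∈ subdifferential u x := by
  constructor
  · rintro ⟨y, hy, φ, h1, h2, h3⟩
    refine ⟨y, hy, -φ, h1.neg, ?_, by simpa using hasGradientAt_neg h3⟩
    have := h2.neg
    refine this.congr (Eventually.of_forall fun z => ?_)
    simp; ring
  · rintro ⟨y, hy, φ, h1, h2, h3⟩
    refine ⟨y, hy, -φ, h1.neg, ?_, hasGradientAt_neg h3⟩
    have := h2.neg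
    refine this.congr (Eventually.of_forall fun z => ?_)
    simp; ring

/-- Subdifferentials may be tested with paraboloids only. -/
theorem quadSuper_iff {H : Torus N → Space N → ℝ} (hH : Continuous (Function.uncurry H))
    (u g : C(Torus N, ℝ)) :
    QuadSuper H u g ↔ ∀ x, ∀ p ∈ subdifferential u x, 0 ≤ H x p + g x := by
  have hH' : Continuous (Function.uncurry fun x p => -H x (-p)) := by
    have : Continuous fun q : Torus N × Space N => -Function.uncurry H (q.1, -q.2) := by fun_prop
    exact this
  rw [QuadSuper, quadSub_iff hH']
  constructor
  · intro h x p hp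
    have := h x (-p) (neg_mem_superdifferential_neg.2 hp)
    simp only [neg_neg, ContinuousMap.neg_apply] at this
    linarith
  · intro h x p hp
    have := h x (-p) (neg_mem_superdifferential_neg.1 (by simpa using hp))
    simp only [ContinuousMap.neg_apply]
    linarith

theorem quadSuper_def {H : Torus N → Space N → ℝ} {u g : C(Torus N, ℝ)} :
    QuadSuper H u g ↔ ∀ (y p : Space N) (A : ℝ), 0 ≤ A →
      (∀ z, u (proj y) + (⟪p, z - y⟫ - A * ‖z - y‖ ^ 2) ≤ u (proj z)) →
      0 ≤ H (proj y) p + g (proj y) := by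
  constructor
  · intro h y p A hA ht
    have := h y (-p) A hA fun z => by
      have := ht z
      simp only [ContinuousMap.neg_apply, inner_neg_left]
      linarith
    simp only [neg_neg, ContinuousMap.neg_apply] at this
    linarith
  · intro h y p A hA ht
    have := h y (-p) A hA fun z => by
      have := ht z
      simp only [ContinuousMap.neg_apply] at this
      simp only [inner_neg_left]
      linarith
    simp only [ContinuousMap.neg_apply]
    linarith

/-! ### Stability under uniform convergence -/

/-- The set of pairs `(u, g)` with `H(x, Du) + g ≤ 0` is closed. -/
theorem isClosed_quadSub {H : Torus N → Space N → ℝ} (hH : Continuous (Function.uncurry H)) :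
    IsClosed {q : C(Torus N, ℝ) × C(Torus N, ℝ) | QuadSub H q.1 q.2} := by
  refine IsSeqClosed.isClosed fun {v q} hv hlim => ?_
  intro y p A hA htest
  -- Opening `A + 1` instead of `A` makes `y` a strict maximum for the limit function, which forces
  -- the perturbed maxima `w n` to converge to `y`.
  have hmax := fun n => exists_max_sub_quadratic (v n).1 isClosed_univ Set.univ_nonempty y p
    (A := A + 1) (by positivity)
  choose w _ hw using hmax
  have hv1 : Tendsto (fun n => (v n).1) atTop (𝓝 q.1) := (continuous_fst.tendsto q).comp hlim
  have hv2 : Tendsto (fun n => (v n).2) atTop (𝓝 q.2) := (continuous_snd.tendsto q).comp hlim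
  have hdist : ∀ n, ‖w n - y‖ ^ 2 ≤ 2 * ‖(v n).1 - q.1‖ := fun n => by
    have h1 := hw n y trivial
    have h2 := htest (w n)
    have h3 := (abs_le.1 (le_norm_apply ((v n).1 - q.1) (proj (w n)))).2
    have h4 := (abs_le.1 (le_norm_apply ((v n).1 - q.1) (proj y))).1
    simp only [ContinuousMap.sub_apply] at h3 h4
    simp only [sub_self, inner_zero_right, norm_zero] at h1
    linarith
  have hw0 : Tendsto (fun n => w n - y) atTop (𝓝 0) := by
    rw [tendsto_zero_iff_norm_tendsto_zero]
    have h1 : Tendsto (fun n => 2 * ‖(v n).1 - q.1‖) atTop (𝓝 0) := by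
      simpa using (tendsto_iff_norm_sub_tendsto_zero.1 hv1).const_mul 2
    have h2 := (squeeze_zero (fun n => by positivity) hdist h1).sqrt
    simpa [Real.sqrt_sq] using h2
  have hwy : Tendsto w atTop (𝓝 y) := by simpa using hw0.add_const y
  have hp : Tendsto (fun n => p + (2 * (A + 1)) • (w n - y)) atTop (𝓝 p) := by
    simpa using (hw0.const_smul (2 * (A + 1))).const_add p
  have hproj : Tendsto (fun n => proj (w n)) atTop (𝓝 (proj y)) :=
    (continuous_proj.tendsto y).comp hwy
  have hsub : ∀ n, H (proj (w n)) (p + (2 * (A + 1)) • (w n - y)) + (v n).2 (proj (w n)) ≤ 0 :=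
    fun n => hv n _ _ (A + 1) (by positivity) fun z => by
      have h1 := hw n z trivial
      have h2 := quadratic_recenter p y (w n) z (A + 1)
      linarith
  have l1 : Tendsto (fun n => H (proj (w n)) (p + (2 * (A + 1)) • (w n - y))) atTop
      (𝓝 (H (proj y) p)) := (hH.tendsto (proj y, p)).comp (hproj.prodMk_nhds hp)
  have l2 : Tendsto (fun n => (v n).2 (proj (w n))) atTop (𝓝 (q.2 (proj y))) :=
    (continuous_eval.tendsto (q.2, proj y)).comp (hv2.prodMk_nhds hproj)
  exact le_of_tendsto (l1.add l2) (Eventually.of_forall hsub)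

theorem isClosed_quadSuper {H : Torus N → Space N → ℝ} (hH : Continuous (Function.uncurry H)) :
    IsClosed {q : C(Torus N, ℝ) × C(Torus N, ℝ) | QuadSuper H q.1 q.2} := by
  have hH' : Continuous (Function.uncurry fun x p => -H x (-p)) := by
    have : Continuous fun q : Torus N × Space N => -Function.uncurry H (q.1, -q.2) := by fun_prop
    exact this
  have := (isClosed_quadSub hH').preimage
    (f := fun q : C(Torus N, ℝ) × C(Torus N, ℝ) => (-q.1, -q.2)) (by fun_prop)
  exact this

/-! ### Lipschitz bounds and compactness -/

/-- A function whose quadratic tests from above have gradients bounded by `K` is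
`K`-Lipschitz. -/
theorem lipschitz_of_quadratic_tests {u : C(Torus N, ℝ)} {K : ℝ} (hK : 0 ≤ K)
    (h : ∀ (y p : Space N) (A : ℝ), 0 ≤ A →
      (∀ z, u (proj z) ≤ u (proj y) + (⟪p, z - y⟫ + A * ‖z - y‖ ^ 2)) → ‖p‖ ≤ K)
    (y z : Space N) : u (proj z) ≤ u (proj y) + K * ‖z - y‖ := by
  have key : ∀ K' > K, ∀ z, u (proj z) ≤ u (proj y) + K' * ‖z - y‖ := by
    intro K' hK' z
    have hpos : 0 < K' := hK.trans_lt hK'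
    have hproj := continuous_proj (N := N)
    obtain ⟨w, -, hw⟩ := exists_max_of_le_sub_norm isClosed_univ Set.univ_nonempty
      (F := fun z : Space N => u (proj z) - K' * ‖z - y‖) (by fun_prop) (C := ‖u‖) hpos y
      fun z => by linarith [(abs_le.1 (le_norm_apply u (proj z))).2]
    have hwy : w = y := by
      by_contra hne
      have hρ : 0 < ‖w - y‖ := norm_pos_iff.2 (sub_ne_zero.2 hne)
      set ρ := ‖w - y‖ with hρdef
      have hp : ‖(K' / ρ) • (w - y)‖ ≤ K := by
        -- Away from its vertex, the cone of slope `K'` is touched from above at `w` by a paraboloid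
        -- centred at `y`, whose gradient at `w` has norm `K' > K`.
        refine h w _ (K' / (2 * ρ)) (by positivity) fun z => ?_
        have h1 := hw z trivial
        have h2 : K' * ‖z - y‖ ≤ K' / (2 * ρ) * ‖z - y‖ ^ 2 + K' * ρ / 2 := by
          have : K' / (2 * ρ) * ‖z - y‖ ^ 2 + K' * ρ / 2 - K' * ‖z - y‖ =
            K' / (2 * ρ) * (‖z - y‖ - ρ) ^ 2 := by field_simp; ring
          have : 0 ≤ K' / (2 * ρ) * (‖z - y‖ - ρ) ^ 2 := by positivity
          linarith
        have h3 := quadratic_recenter (0 : Space N) y w z (K' / (2 * ρ))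
        have h4 : 2 * (K' / (2 * ρ)) = K' / ρ := by field_simp
        rw [h4] at h3
        simp only [inner_zero_left, zero_add, ← hρdef] at h3
        have h5 : K' / (2 * ρ) * ρ ^ 2 = K' * ρ / 2 := by field_simp
        linarith
      rw [norm_smul, Real.norm_of_nonneg (by positivity), ← hρdef, div_mul_cancel₀ _ hρ.ne'] at hp
      linarith
    have := hw z trivial
    rw [hwy] at this
    simp only [sub_self, norm_zero] at this
    linarith
  by_contra hcon
  push Not at hcon
  set δ := u (proj z) - (u (proj y) + K * ‖z - y‖) with hδ
  have hδpos : 0 < δ := by linarith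
  -- The extra slope contributes at most `δ / 2`, half of the assumed violation.
  have h1 := key (K + δ / (2 * (‖z - y‖ + 1))) (by
    have : 0 < δ / (2 * (‖z - y‖ + 1)) := by positivity
    linarith) z
  have h2 : δ / (2 * (‖z - y‖ + 1)) * ‖z - y‖ ≤ δ / 2 := by
    rw [div_mul_eq_mul_div, div_le_div_iff₀ (by positivity) (by positivity)]
    nlinarith [norm_nonneg (z - y)]
  linarith

/-- A bound at the points where a continuous function has quadratic tests from above holds
everywhere. -/
theorem le_of_le_at_quadratic_tests (u g : C(Torus N, ℝ)) {C : ℝ}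
    (h : ∀ (y p : Space N) (A : ℝ), 0 ≤ A →
      (∀ z, u (proj z) ≤ u (proj y) + (⟪p, z - y⟫ + A * ‖z - y‖ ^ 2)) → g (proj y) ≤ C)
    (x : Torus N) : g x ≤ C := by
  obtain ⟨y, rfl⟩ := proj_surjective x
  -- Ever steeper paraboloids centred at `y` give contact points converging to `y`: the points with
  -- a test from above are dense.
  have hmax := fun n : ℕ => exists_max_sub_quadratic u isClosed_univ Set.univ_nonempty y 0
    (A := (n : ℝ) + 1) (by positivity)
  choose w _ hw using hmax
  have hdist : ∀ n : ℕ, ‖w n - y‖ ^ 2 ≤ 2 * ‖u‖ * (1 / ((n : ℝ) + 1)) := fun n => by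
    have h1 := hw n y trivial
    have h3 := (abs_le.1 (le_norm_apply u (proj (w n)))).2
    have h4 := (abs_le.1 (le_norm_apply u (proj y))).1
    simp only [sub_self, inner_zero_right, inner_zero_left, norm_zero] at h1
    rw [mul_one_div, le_div_iff₀ (by positivity)]
    linarith
  have hw0 : Tendsto (fun n => w n - y) atTop (𝓝 0) := by
    rw [tendsto_zero_iff_norm_tendsto_zero]
    have h1 : Tendsto (fun n : ℕ => 2 * ‖u‖ * (1 / ((n : ℝ) + 1))) atTop (𝓝 0) := by
      simpa using tendsto_one_div_add_atTop_nhds_zero_nat.const_mul (2 * ‖u‖)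
    have h2 := (squeeze_zero (fun n => by positivity) hdist h1).sqrt
    simpa [Real.sqrt_sq] using h2
  have hwy : Tendsto w atTop (𝓝 y) := by simpa using hw0.add_const y
  have hlim : Tendsto (fun n => g (proj (w n))) atTop (𝓝 (g (proj y))) :=
    ((g.continuous.comp continuous_proj).tendsto y).comp hwy
  refine le_of_tendsto hlim (Eventually.of_forall fun n => ?_)
  refine h (w n) (0 + (2 * ((n : ℝ) + 1)) • (w n - y)) ((n : ℝ) + 1) (by positivity) fun z => ?_
  have h1 := hw n z trivial
  have h2 := quadratic_recenter 0 y (w n) z ((n : ℝ) + 1)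
  linarith

/-- The functions on the torus with a given bound and a given Lipschitz constant on lifts. -/
def lipschitzBall (N : ℕ) (R K : ℝ) : Set C(Torus N, ℝ) :=
  {f | ‖f‖ ≤ R ∧ ∀ y z : Space N, f (proj z) ≤ f (proj y) + K * ‖z - y‖}

/-- Arzelà–Ascoli. Since `proj` is open, points near `proj y` have lifts near `y`, so the bound on
lifts gives equicontinuity. It also makes any function satisfying it continuous, so the pointwise
conditions cut out a closed subset of a product of intervals. -/
theorem isCompact_lipschitzBall (N : ℕ) {R : ℝ} (hR : 0 ≤ R) (K : ℝ) :
    IsCompact (lipschitzBall N R K) := by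
  have habs : ∀ f : Torus N → ℝ, (∀ y z : Space N, f (proj z) ≤ f (proj y) + K * ‖z - y‖) →
      ∀ y z, |f (proj z) - f (proj y)| ≤ K * ‖z - y‖ := fun f hf y z => by
    have h1 := hf y z
    have h2 := hf z y
    rw [norm_sub_rev] at h2
    exact abs_le.2 ⟨by linarith, by linarith⟩
  have hev : ∀ (y : Space N) (ε : ℝ), 0 < ε →
      ∀ᶠ x in 𝓝 (proj y), ∃ z, proj z = x ∧ K * ‖z - y‖ < ε := fun y ε hε => by
    have hopen : IsOpen {z : Space N | K * ‖z - y‖ < ε} :=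
      isOpen_lt (by fun_prop) continuous_const
    filter_upwards [(isOpenQuotientMap_proj.isOpenMap _ hopen).mem_nhds ⟨y, by simpa, rfl⟩]
      with x ⟨z, hz, hzx⟩
    exact ⟨z, hzx, hz⟩
  refine ArzelaAscoli.isCompact_of_equicontinuous _ ?_ ?_
  · have himage : ContinuousMap.toFun '' lipschitzBall N R K =
        Set.pi Set.univ (fun _ => Set.Icc (-R) R) ∩
        {f | ∀ y z : Space N, f (proj z) ≤ f (proj y) + K * ‖z - y‖} := by
      ext f
      constructor
      · rintro ⟨f, ⟨h1, h2⟩, rfl⟩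
        exact ⟨fun x _ => abs_le.1 ((le_norm_apply f x).trans h1), h2⟩
      · rintro ⟨h1, h2⟩
        have hc : Continuous f := continuous_iff_continuousAt.2 fun x => by
          obtain ⟨y, rfl⟩ := proj_surjective x
          refine Metric.tendsto_nhds.2 fun ε hε => ?_
          filter_upwards [hev y ε hε] with x ⟨z, hzx, hz⟩
          rw [← hzx, Real.dist_eq]
          exact (habs f h2 y z).trans_lt hz
        refine ⟨⟨f, hc⟩, ⟨?_, h2⟩, rfl⟩
        exact (ContinuousMap.norm_le _ hR).2 fun x => abs_le.2 (h1 x trivial)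
    rw [himage]
    refine (isCompact_univ_pi fun _ => isCompact_Icc).inter_right ?_
    simp only [Set.ofPred_forall]
    exact isClosed_iInter fun y => isClosed_iInter fun z =>
      isClosed_le (continuous_apply _) ((continuous_apply _).add continuous_const)
  · intro x
    obtain ⟨y, rfl⟩ := proj_surjective x
    refine Metric.equicontinuousAt_iff_right.2 fun ε hε => ?_
    filter_upwards [hev y ε hε] with x ⟨z, hzx, hz⟩ f
    rw [← hzx, dist_comm, Real.dist_eq]
    exact (habs _ f.2.2 y z).trans_lt hz

/-! ### Weakly coupled systems with a zeroth order term -/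

/-- The function `∑_j b_ij u_j + l u_i - a`. -/
def zerothOrder (b : Fin m → Fin m → C(Torus N, ℝ)) (l a : ℝ) (u : Fin m → C(Torus N, ℝ))
    (i : Fin m) : C(Torus N, ℝ) :=
  ∑ j, b i j * u j + l • u i - a • (1 : C(Torus N, ℝ))

theorem zerothOrder_apply (b : Fin m → Fin m → C(Torus N, ℝ)) (l a : ℝ)
    (u : Fin m → C(Torus N, ℝ)) (i : Fin m) (x : Torus N) :
    zerothOrder b l a u i x = ∑ j, b i j x * u j x + l * u i x - a := by
  simp [zerothOrder]

/-- Subsolutions of `H_i(x, Du_i) + ∑_j b_ij u_j + l u_i = a`. -/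
def SystemSub (H : Fin m → Torus N → Space N → ℝ) (b : Fin m → Fin m → C(Torus N, ℝ)) (l a : ℝ)
    (u : Fin m → C(Torus N, ℝ)) : Prop :=
  ∀ i, QuadSub (H i) (u i) (zerothOrder b l a u i)

/-- Supersolutions of `H_i(x, Du_i) + ∑_j b_ij u_j + l u_i = a`. -/
def SystemSuper (H : Fin m → Torus N → Space N → ℝ) (b : Fin m → Fin m → C(Torus N, ℝ)) (l a : ℝ)
    (u : Fin m → C(Torus N, ℝ)) : Prop :=
  ∀ i, QuadSuper (H i) (u i) (zerothOrder b l a u i)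

/-- The discount and the right-hand side are variables here because they pass to the limit together
with the solutions. -/
theorem continuous_zerothOrder (b : Fin m → Fin m → C(Torus N, ℝ)) (i : Fin m) :
    Continuous fun q : ℝ × ℝ × (Fin m → C(Torus N, ℝ)) =>
      (q.2.2 i, zerothOrder b q.1 q.2.1 q.2.2 i) := by
  unfold zerothOrder
  fun_prop

theorem isClosed_systemSub {H : Fin m → Torus N → Space N → ℝ}
    (hH : ∀ i, Continuous (Function.uncurry (H i))) (b : Fin m → Fin m → C(Torus N, ℝ)) :
    IsClosed {q : ℝ × ℝ × (Fin m → C(Torus N, ℝ)) | SystemSub H b q.1 q.2.1 q.2.2} := by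
  simp only [SystemSub, Set.ofPred_forall]
  exact isClosed_iInter fun i => (isClosed_quadSub (hH i)).preimage (continuous_zerothOrder b i)

theorem isClosed_systemSuper {H : Fin m → Torus N → Space N → ℝ}
    (hH : ∀ i, Continuous (Function.uncurry (H i))) (b : Fin m → Fin m → C(Torus N, ℝ)) :
    IsClosed {q : ℝ × ℝ × (Fin m → C(Torus N, ℝ)) | SystemSuper H b q.1 q.2.1 q.2.2} := by
  simp only [SystemSuper, Set.ofPred_forall]
  exact isClosed_iInter fun i => (isClosed_quadSuper (hH i)).preimage (continuous_zerothOrder b i)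

/-- Hamiltonians that are coercive uniformly in the component and in the position. -/
def UniformlyCoercive (H : Fin m → Torus N → Space N → ℝ) : Prop :=
  ∀ C : ℝ, ∃ K : ℝ, 0 ≤ K ∧ ∀ i x p, H i x p ≤ C → ‖p‖ ≤ K

/-- Subsolutions with a lower bound on the zeroth order terms are Lipschitz. -/
theorem UniformlyCoercive.exists_lipschitz {H : Fin m → Torus N → Space N → ℝ}
    (hcoer : UniformlyCoercive H) (C : ℝ) : ∃ K : ℝ, 0 ≤ K ∧ ∀ b l a u, SystemSub H b l a u →
      (∀ i x, -C ≤ zerothOrder b l a u i x) →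
        ∀ i (y z : Space N), u i (proj z) ≤ u i (proj y) + K * ‖z - y‖ := by
  obtain ⟨K, hK, h⟩ := hcoer C
  refine ⟨K, hK, fun b l a u hu hg i => lipschitz_of_quadratic_tests hK fun y p A hA ht => ?_⟩
  exact h i (proj y) p (by linarith [hu i y p A hA ht, hg i (proj y)])

/-- Bounded sets of subsolutions are compact. -/
theorem isCompact_bounded_subsolutions {H : Fin m → Torus N → Space N → ℝ}
    (hH : ∀ i, Continuous (Function.uncurry (H i))) (hcoer : UniformlyCoercive H)
    (b : Fin m → Fin m → C(Torus N, ℝ)) (L A : ℝ) {R : ℝ} (hR : 0 ≤ R) :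
    IsCompact {q : ℝ × ℝ × (Fin m → C(Torus N, ℝ)) | q.1 ∈ Set.Icc 0 L ∧ q.2.1 ∈ Set.Icc (-A) A ∧
      (∀ i, ‖q.2.2 i‖ ≤ R) ∧ SystemSub H b q.1 q.2.1 q.2.2} := by
  obtain ⟨K, hK, hlip⟩ := hcoer.exists_lipschitz ((∑ i, ∑ j, ‖b i j‖) * R + L * R + A)
  refine ((isCompact_Icc (a := (0 : ℝ)) (b := L)).prod ((isCompact_Icc (a := -A) (b := A)).prod
    (isCompact_univ_pi fun _ : Fin m => isCompact_lipschitzBall N hR K))).of_isClosed_subset ?_ ?_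
  · have h1 : IsClosed {q : ℝ × ℝ × (Fin m → C(Torus N, ℝ)) | q.1 ∈ Set.Icc 0 L} :=
      isClosed_Icc.preimage continuous_fst
    have h2 : IsClosed {q : ℝ × ℝ × (Fin m → C(Torus N, ℝ)) | q.2.1 ∈ Set.Icc (-A) A} :=
      isClosed_Icc.preimage (continuous_fst.comp continuous_snd)
    have h3 : IsClosed {q : ℝ × ℝ × (Fin m → C(Torus N, ℝ)) | ∀ i, ‖q.2.2 i‖ ≤ R} := by
      simp only [Set.ofPred_forall]
      exact isClosed_iInter fun i => isClosed_le (by fun_prop) continuous_const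
    exact h1.inter (h2.inter (h3.inter (isClosed_systemSub hH b)))
  · rintro ⟨l, a, u⟩ ⟨h1, h2, h3, h4⟩
    refine ⟨h1, h2, fun i _ => ⟨h3 i, hlip b l a u h4 (fun i x => ?_) i⟩⟩
    simp only [Set.mem_Icc] at h1 h2 h3
    rw [zerothOrder_apply]
    have hx : ∀ j, |u j x| ≤ R := fun j => (le_norm_apply _ x).trans (h3 j)
    have e1 : |∑ j, b i j x * u j x| ≤ (∑ i, ∑ j, ‖b i j‖) * R := by
      calc |∑ j, b i j x * u j x| ≤ ∑ j, |b i j x * u j x| := Finset.abs_sum_le_sum_abs _ _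
        _ ≤ ∑ j, ‖b i j‖ * R := by
          refine Finset.sum_le_sum fun j _ => ?_
          rw [abs_mul]
          exact mul_le_mul (le_norm_apply _ x) (hx j) (abs_nonneg _) (norm_nonneg _)
        _ = (∑ j, ‖b i j‖) * R := by rw [Finset.sum_mul]
        _ ≤ _ := by
          refine mul_le_mul_of_nonneg_right ?_ hR
          exact Finset.single_le_sum (f := fun i => ∑ j, ‖b i j‖)
            (fun i _ => Finset.sum_nonneg fun j _ => norm_nonneg _) (Finset.mem_univ i)
    have e2 : |l * u i x| ≤ L * R := by
      rw [abs_mul, abs_of_nonneg h1.1]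
      exact mul_le_mul h1.2 (hx i) (abs_nonneg _) (h1.1.trans h1.2)
    linarith [(abs_le.1 e1).1, (abs_le.1 e2).1]

/-! ### Degenerate irreducible couplings -/

/-- Continuous coupling matrices that are degenerate and irreducible at every point. -/
structure DegenerateCoupling (b : Fin m → Fin m → C(Torus N, ℝ)) : Prop where
  off_diag_nonpos : ∀ i j x, j ≠ i → b i j x ≤ 0
  row_sum : ∀ i x, ∑ j, b i j x = 0
  irreducible : ∀ (x : Torus N) (I : Set (Fin m)), I.Nonempty → I ≠ Set.univ →
    ∃ i ∈ I, ∃ j ∉ I, b i j x ≠ 0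

namespace DegenerateCoupling

variable {b : Fin m → Fin m → C(Torus N, ℝ)}

theorem sum_mul_sub_const (hb : DegenerateCoupling b) (i : Fin m) (x : Torus N) (f : Fin m → ℝ)
    (k : ℝ) : ∑ j, b i j x * (f j - k) = ∑ j, b i j x * f j := by
  simp only [mul_sub, Finset.sum_sub_distrib, ← Finset.sum_mul, hb.row_sum, zero_mul, sub_zero]

/-- At a maximal component the coupling term is nonnegative. -/
theorem sum_nonneg_of_max (hb : DegenerateCoupling b) {i : Fin m} {f : Fin m → ℝ}
    (hf : ∀ j, f j ≤ f i) (x : Torus N) : 0 ≤ ∑ j, b i j x * f j := by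
  rw [← hb.sum_mul_sub_const i x f (f i)]
  refine Finset.sum_nonneg fun j _ => ?_
  rcases eq_or_ne j i with rfl | hj
  · simp
  · exact mul_nonneg_of_nonpos_of_nonpos (hb.off_diag_nonpos i j x hj) (by linarith [hf j])

/-- Vectors on which an irreducible degenerate coupling is nonpositive are constant. -/
theorem eq_of_sum_nonpos (hb : DegenerateCoupling b) {x : Torus N} {f : Fin m → ℝ}
    (h : ∀ i, ∑ j, b i j x * f j ≤ 0) {i : Fin m} (hi : ∀ j, f j ≤ f i) (k : Fin m) :
    f k = f i := by
  by_contra hk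
  -- Irreducibility is applied to the set where `f` is maximal. In row `l` all terms are nonnegative
  -- with nonpositive sum, so they vanish, although `b l j x ≠ 0` and `f j < f l`.
  obtain ⟨l, hl, j, hj, hne⟩ := hb.irreducible x {l | f l = f i} ⟨i, rfl⟩
    (fun h => hk (h ▸ Set.mem_univ k : k ∈ {l | f l = f i}))
  have hl : f l = f i := hl
  have hj : f j ≠ f i := hj
  have hterm : ∀ j, 0 ≤ b l j x * (f j - f l) := fun j => by
    rcases eq_or_ne j l with rfl | hjl
    · simp
    · exact mul_nonneg_of_nonpos_of_nonpos (hb.off_diag_nonpos l j x hjl)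
        (by linarith [hi j])
  have hle := h l
  rw [← hb.sum_mul_sub_const l x f (f l)] at hle
  have hz := (Finset.sum_eq_zero_iff_of_nonneg fun j _ => hterm j).1
    (le_antisymm hle (Finset.sum_nonneg fun j _ => hterm j)) j (Finset.mem_univ j)
  rcases mul_eq_zero.1 hz with h0 | h0
  · exact hne h0
  · exact hj (by linarith)

/-- An upper bound on all the components of the coupling term bounds the oscillation among the
components, uniformly on the torus. -/
theorem exists_oscillation_bound (hb : DegenerateCoupling b) {C : ℝ} (hC : 0 ≤ C) :
    ∃ R : ℝ, 0 ≤ R ∧ ∀ (x : Torus N) (f : Fin m → ℝ), (∀ i, ∑ j, b i j x * f j ≤ C) →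
      ∀ i k, f i - f k ≤ R := by
  -- Vectors normalized to have minimum 0 and maximum 1. On this compact set the positive parts of
  -- the coupling terms cannot all vanish, so their sum `Φ` has a positive minimum; homogeneity then
  -- gives the bound.
  set S : Set (Torus N × (Fin m → ℝ)) := Set.univ ×ˢ
    (Set.pi Set.univ (fun _ => Set.Icc 0 1) ∩ ⋃ i, ⋃ k, {f | f i = 1 ∧ f k = 0}) with hS
  have hScomp : IsCompact S := by
    refine isCompact_univ.prod ((isCompact_univ_pi fun _ => isCompact_Icc).inter_right ?_)
    refine isClosed_iUnion_of_finite fun i => isClosed_iUnion_of_finite fun k => ?_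
    exact (isClosed_eq (continuous_apply i) continuous_const).inter
      (isClosed_eq (continuous_apply k) continuous_const)
  set Φ : Torus N × (Fin m → ℝ) → ℝ := fun q => ∑ i, max 0 (∑ j, b i j q.1 * q.2 j) with hΦ
  have hΦc : Continuous Φ := by fun_prop
  have hpos : ∀ q ∈ S, 0 < Φ q := by
    rintro ⟨x, f⟩ ⟨-, hf, hf'⟩
    simp only [Set.mem_iUnion] at hf'
    obtain ⟨i, k, hi, hk⟩ := hf'
    by_contra hcon
    have hzero := (Finset.sum_eq_zero_iff_of_nonneg fun i _ => le_max_left 0 _).1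
      (le_antisymm (not_lt.1 hcon) (Finset.sum_nonneg fun i _ => le_max_left 0 _))
    have := hb.eq_of_sum_nonpos (x := x) (f := f)
      (fun l => (le_max_right _ _).trans (hzero l (Finset.mem_univ l)).le) (i := i)
      (fun j => hi ▸ (hf j trivial).2) k
    rw [hi, hk] at this
    exact zero_ne_one this
  have hscale : ∀ (x : Torus N) (f : Fin m → ℝ), (∀ i, ∑ j, b i j x * f j ≤ C) → ∀ i k,
      (∀ j, f j ≤ f i) → (∀ j, f k ≤ f j) → 0 < f i - f k →
      ∃ q ∈ S, Φ q * (f i - f k) ≤ m * C := by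
    intro x f hf i k hi hk hr
    refine ⟨(x, fun j => (f j - f k) / (f i - f k)), ⟨trivial, fun j _ => ⟨?_, ?_⟩, ?_⟩, ?_⟩
    · exact div_nonneg (by linarith [hk j]) hr.le
    · exact (div_le_one hr).2 (by linarith [hi j])
    · simp only [Set.mem_iUnion]
      exact ⟨i, k, div_self hr.ne', by simp⟩
    · rw [hΦ, Finset.sum_mul]
      calc ∑ l, max 0 (∑ j, b l j x * ((f j - f k) / (f i - f k))) * (f i - f k)
          ≤ ∑ _l : Fin m, C := by
            refine Finset.sum_le_sum fun l _ => ?_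
            rw [max_mul_of_nonneg _ _ hr.le, zero_mul, Finset.sum_mul]
            refine max_le hC (le_trans (le_of_eq ?_) (hf l))
            rw [← hb.sum_mul_sub_const l x f (f k)]
            refine Finset.sum_congr rfl fun j _ => ?_
            field_simp
        _ = m * C := by simp
  have hargs : ∀ f : Fin m → ℝ, ∀ l : Fin m, ∃ i k, (∀ j, f j ≤ f i) ∧ ∀ j, f k ≤ f j := by
    intro f l
    have : Nonempty (Fin m) := ⟨l⟩
    obtain ⟨i, hi⟩ := Finite.exists_max f
    obtain ⟨k, hk⟩ := Finite.exists_min f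
    exact ⟨i, k, hi, hk⟩
  -- `S` is empty exactly when `m ≤ 1`, where there is no oscillation among components.
  rcases S.eq_empty_or_nonempty with hempty | hne
  · refine ⟨0, le_rfl, fun x f hf i' k' => ?_⟩
    obtain ⟨i, k, hi, hk⟩ := hargs f i'
    by_contra hcon
    obtain ⟨q, hq, -⟩ := hscale x f hf i k hi hk (by linarith [hi i', hk k'])
    exact (hempty ▸ hq : q ∈ (∅ : Set _))
  · obtain ⟨q₀, hq₀, hmin⟩ := hScomp.exists_isMinOn hne hΦc.continuousOn
    have hη := hpos q₀ hq₀
    refine ⟨m * C / Φ q₀, by positivity, fun x f hf i' k' => ?_⟩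
    obtain ⟨i, k, hi, hk⟩ := hargs f i'
    refine le_trans (b := f i - f k) (by linarith [hi i', hk k']) ?_
    rcases le_or_gt (f i - f k) 0 with hr | hr
    · exact hr.trans (by positivity)
    · obtain ⟨q, hq, hle⟩ := hscale x f hf i k hi hk hr
      rw [le_div_iff₀ hη]
      have : Φ q₀ * (f i - f k) ≤ Φ q * (f i - f k) :=
        mul_le_mul_of_nonneg_right (hmin hq) hr.le
      linarith

end DegenerateCoupling

/-! ### Comparison of the right-hand sides -/

/-- The doubled function with a quadratic penalization attains its maximum, also with respect to
the component. -/
theorem exists_max_doubling (hm : 0 < m) (v u : Fin m → C(Torus N, ℝ)) {c : ℝ} (hc : 1 ≤ c) :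
    ∃ (i : Fin m) (s z : Space N), ∀ (j : Fin m) (s' z' : Space N),
      v j (proj s') - u j (proj z') - c * ‖z' - s'‖ ^ 2 ≤
        v i (proj s) - u i (proj z) - c * ‖z - s‖ ^ 2 := by
  have : Nonempty (Fin m) := ⟨⟨0, hm⟩⟩
  set R := ∑ i, (‖v i‖ + ‖u i‖) with hR
  have hR0 : 0 ≤ R := Finset.sum_nonneg fun i _ => by positivity
  have hbound : ∀ i x x', |v i x - u i x'| ≤ R := fun i x x' => by
    have h1 : ‖v i‖ + ‖u i‖ ≤ R :=
      Finset.single_le_sum (f := fun i => ‖v i‖ + ‖u i‖) (fun i _ => by positivity)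
        (Finset.mem_univ i)
    calc |v i x - u i x'| ≤ |v i x| + |u i x'| := abs_sub _ _
      _ ≤ ‖v i‖ + ‖u i‖ := add_le_add (le_norm_apply _ _) (le_norm_apply _ _)
      _ ≤ R := h1
  -- The pair of lifts is replaced by a point of the torus and the difference of the lifts. The
  -- torus is compact, and beyond radius `2 * R + 1` the penalty exceeds the possible gain `2 * R`.
  set Φ : Fin m × Torus N × Space N → ℝ :=
    fun q => v q.1 q.2.1 - u q.1 (q.2.1 + proj q.2.2) - c * ‖q.2.2‖ ^ 2 with hΦ
  have hproj := continuous_proj (N := N)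
  have hΦc : Continuous Φ := by
    rw [continuous_prod_of_discrete_left]
    intro i
    simp only [hΦ]
    fun_prop
  obtain ⟨⟨i, x, h⟩, -, hmax⟩ := ((isCompact_univ (X := Fin m)).prod
    ((isCompact_univ (X := Torus N)).prod
      (isCompact_closedBall (0 : Space N) (2 * R + 1)))).exists_isMaxOn
    ⟨(Classical.arbitrary _, 0, 0), trivial, trivial, by simp; positivity⟩ hΦc.continuousOn
  have hglob : ∀ q, Φ q ≤ Φ (i, x, h) := by
    rintro ⟨j, x', h'⟩
    rcases le_or_gt ‖h'‖ (2 * R + 1) with hle | hgt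
    · exact hmax ⟨trivial, trivial, by simpa using hle⟩
    · have h0 : Φ (j, x', 0) ≤ Φ (i, x, h) :=
        hmax ⟨trivial, trivial, by simp; positivity⟩
      refine le_trans ?_ h0
      have e1 := (abs_le.1 (hbound j x' (x' + proj h'))).2
      have e2 := (abs_le.1 (hbound j x' (x' + proj (0 : Space N)))).1
      simp only [hΦ, norm_zero]
      have e3 : 2 * R + 1 ≤ c * ‖h'‖ ^ 2 := by nlinarith [norm_nonneg h']
      linarith
  obtain ⟨s, rfl⟩ := proj_surjective x
  refine ⟨i, s, s + h, fun j s' z' => ?_⟩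
  have := hglob (j, proj s', z' - s')
  simpa [hΦ, ← proj_add] using this

/-- If the system with right-hand side `a` has a subsolution and the one with right-hand side `a'`
has a supersolution then `a' ≤ a`. -/
theorem SystemSub.le_of_systemSuper (hm : 0 < m) {H : Fin m → Torus N → Space N → ℝ}
    (hH : ∀ i, Continuous (Function.uncurry (H i))) (hcoer : UniformlyCoercive H)
    {b : Fin m → Fin m → C(Torus N, ℝ)} (hb : DegenerateCoupling b) {a a' : ℝ}
    {v u : Fin m → C(Torus N, ℝ)} (hv : SystemSub H b 0 a v) (hu : SystemSuper H b 0 a' u) :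
    a' ≤ a := by
  have hdoub := fun n : ℕ => exists_max_doubling hm v u (c := (n : ℝ) + 1)
    (by linarith [(Nat.cast_nonneg n : (0 : ℝ) ≤ n)])
  choose i s z hmax using hdoub
  -- The common momentum: the penalization gives the same gradient for the test of `v` at `s n` and
  -- that of `u` at `z n`.
  set p : ℕ → Space N := fun n => (2 * ((n : ℝ) + 1)) • (s n - z n) with hp
  have hsub : ∀ n, H (i n) (proj (s n)) (p n) + zerothOrder b 0 a v (i n) (proj (s n)) ≤ 0 := by
    intro n
    refine hv (i n) (s n) (p n) ((n : ℝ) + 1) (by positivity) fun y => ?_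
    have h1 := hmax n (i n) y (z n)
    have h2 := quadratic_recenter 0 (z n) (s n) y ((n : ℝ) + 1)
    simp only [inner_zero_left, zero_add] at h2
    rw [norm_sub_rev (z n) y, norm_sub_rev (z n) (s n)] at h1
    linarith
  have hsup : ∀ n, 0 ≤ H (i n) (proj (z n)) (p n) + zerothOrder b 0 a' u (i n) (proj (z n)) := by
    intro n
    refine quadSuper_def.1 (hu (i n)) (z n) (p n) ((n : ℝ) + 1) (by positivity) fun y => ?_
    have h1 := hmax n (i n) (s n) y
    have h2 := quadratic_recenter 0 (s n) (z n) y ((n : ℝ) + 1)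
    simp only [inner_zero_left, zero_add] at h2
    have h3 : p n = -((2 * ((n : ℝ) + 1)) • (z n - s n)) := by
      rw [hp, ← smul_neg, neg_sub]
    rw [h3, inner_neg_left]
    linarith
  -- Competing with the diagonal point in every component keeps, in the limit, the maximality of the
  -- selected component.
  have hcomp : ∀ n j, v j (proj (s n)) - u j (proj (s n)) ≤
      v (i n) (proj (s n)) - u (i n) (proj (z n)) := by
    intro n j
    have h1 := hmax n j (s n) (s n)
    have h2 : 0 ≤ ((n : ℝ) + 1) * ‖z n - s n‖ ^ 2 := by positivity
    simp only [sub_self, norm_zero] at h1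
    linarith
  obtain ⟨K, hK, hKp⟩ := hcoer (∑ i, ‖zerothOrder b 0 a v i‖)
  have hpK : ∀ n, ‖p n‖ ≤ K := fun n => hKp (i n) (proj (s n)) (p n) (by
    have h1 := (abs_le.1 (le_norm_apply (zerothOrder b 0 a v (i n)) (proj (s n)))).1
    have h2 := Finset.single_le_sum (f := fun i => ‖zerothOrder b 0 a v i‖)
      (fun i _ => norm_nonneg _) (Finset.mem_univ (i n))
    linarith [hsub n])
  have hzs : Tendsto (fun n => z n - s n) atTop (𝓝 0) := by
    rw [tendsto_zero_iff_norm_tendsto_zero]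
    have h1 : Tendsto (fun n : ℕ => K * (1 / ((n : ℝ) + 1))) atTop (𝓝 0) := by
      simpa using tendsto_one_div_add_atTop_nhds_zero_nat.const_mul K
    refine squeeze_zero (fun n => norm_nonneg _) (fun n => ?_) h1
    have h2 := hpK n
    simp only [hp] at h2
    rw [norm_smul, Real.norm_of_nonneg (by positivity), norm_sub_rev] at h2
    rw [mul_one_div, le_div_iff₀ (by positivity)]
    nlinarith [norm_nonneg (z n - s n), (Nat.cast_nonneg n : (0 : ℝ) ≤ n),
      mul_nonneg (Nat.cast_nonneg n : (0 : ℝ) ≤ n) (norm_nonneg (z n - s n))]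
  obtain ⟨⟨i₀, x₀, p₀⟩, -, φ, hφ, hlim⟩ := ((isCompact_univ (X := Fin m)).prod
    ((isCompact_univ (X := Torus N)).prod (isCompact_closedBall (0 : Space N) K))).tendsto_subseq
    (x := fun n => (i n, proj (s n), p n)) fun n => ⟨trivial, trivial, by simpa using hpK n⟩
  have hi : ∀ᶠ n in atTop, i (φ n) = i₀ := by
    have : Tendsto (fun n => i (φ n)) atTop (𝓝 i₀) := (continuous_fst.tendsto _).comp hlim
    rwa [nhds_discrete, tendsto_pure] at this
  have hx : Tendsto (fun n => proj (s (φ n))) atTop (𝓝 x₀) :=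
    ((continuous_fst.comp continuous_snd).tendsto _).comp hlim
  have hp₀ : Tendsto (fun n => p (φ n)) atTop (𝓝 p₀) :=
    ((continuous_snd.comp continuous_snd).tendsto _).comp hlim
  have hz : Tendsto (fun n => proj (z (φ n))) atTop (𝓝 x₀) := by
    have h1 : Tendsto (fun n => proj (z (φ n) - s (φ n))) atTop (𝓝 0) := by
      rw [← proj_zero]
      exact (continuous_proj.tendsto 0).comp (hzs.comp hφ.tendsto_atTop)
    simpa [proj_sub] using h1.add hx
  have limH : ∀ {y : ℕ → Torus N}, Tendsto y atTop (𝓝 x₀) →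
      Tendsto (fun n => H i₀ (y n) (p (φ n))) atTop (𝓝 (H i₀ x₀ p₀)) := fun hy =>
    ((hH i₀).tendsto (x₀, p₀)).comp (hy.prodMk_nhds hp₀)
  have limC : ∀ (f : C(Torus N, ℝ)) {y : ℕ → Torus N}, Tendsto y atTop (𝓝 x₀) →
      Tendsto (fun n => f (y n)) atTop (𝓝 (f x₀)) := fun f _ hy => (f.continuous.tendsto x₀).comp hy
  have f1 : H i₀ x₀ p₀ + zerothOrder b 0 a v i₀ x₀ ≤ 0 :=
    le_of_tendsto ((limH hx).add (limC _ hx)) (hi.mono fun n hn => hn ▸ hsub (φ n))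
  have f2 : 0 ≤ H i₀ x₀ p₀ + zerothOrder b 0 a' u i₀ x₀ :=
    ge_of_tendsto ((limH hz).add (limC _ hz)) (hi.mono fun n hn => hn ▸ hsup (φ n))
  have f3 : ∀ j, v j x₀ - u j x₀ ≤ v i₀ x₀ - u i₀ x₀ := fun j =>
    le_of_tendsto_of_tendsto ((limC _ hx).sub (limC _ hx)) ((limC _ hx).sub (limC _ hz))
      (hi.mono fun n hn => hn ▸ hcomp (φ n) j)
  -- Subtracting `f1` from `f2` cancels the Hamiltonian and leaves `a' - a` bounded by minus this
  -- nonnegative coupling term.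
  have f4 := hb.sum_nonneg_of_max f3 x₀
  simp only [mul_sub, Finset.sum_sub_distrib] at f4
  rw [zerothOrder_apply] at f1 f2
  linarith

/-! ### Maximal elements of compact sets -/

/-- A nonempty compact set has a maximal element, if the sets of upper bounds are closed. -/
theorem exists_maximal_of_isCompact {X : Type*} [PartialOrder X] [TopologicalSpace X] [T2Space X]
    (hIci : ∀ v : X, IsClosed (Set.Ici v)) {G : Set X} (hG : IsCompact G) (hne : G.Nonempty) :
    ∃ u, Maximal (· ∈ G) u := by
  obtain ⟨x, hx⟩ := hne
  have hchain : ∀ c ⊆ G, IsChain (· ≤ ·) c → ∀ y ∈ c, ∃ ub ∈ G, ∀ z ∈ c, z ≤ ub := by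
    intro c hcG hc y hy
    have : Nonempty c := ⟨⟨y, hy⟩⟩
    -- Upper bounds of the chain in `G` are found by intersecting nested nonempty compact sets.
    have hdir : Directed (· ⊇ ·) fun v : c => G ∩ Set.Ici (v : X) := by
      intro v w
      rcases hc.total v.2 w.2 with h | h
      · exact ⟨w, Set.inter_subset_inter_right _ (Set.Ici_subset_Ici.2 h), subset_rfl⟩
      · exact ⟨v, subset_rfl, Set.inter_subset_inter_right _ (Set.Ici_subset_Ici.2 h)⟩
    obtain ⟨z, hz⟩ := IsCompact.nonempty_iInter_of_directed_nonempty_isCompact_isClosed _ hdir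
      (fun v => ⟨v, hcG v.2, Set.self_mem_Ici⟩) (fun v => hG.inter_right (hIci v))
      (fun v => hG.isClosed.inter (hIci v))
    rw [Set.mem_iInter] at hz
    exact ⟨z, (hz ⟨y, hy⟩).1, fun v hv => (hz ⟨v, hv⟩).2⟩
  obtain ⟨u, -, hu⟩ := zorn_le_nonempty₀ G hchain x hx
  exact ⟨u, hu⟩

/-! ### Periodic envelopes of paraboloids -/

/-- A vector whose scalar products are bounded below by a quadratic remainder vanishes. -/
theorem eq_zero_of_quadratic_nonneg {p : Space N} {A : ℝ} (hA : 0 ≤ A)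
    (h : ∀ z : Space N, 0 ≤ ⟪p, z⟫ + A * ‖z‖ ^ 2) : p = 0 := by
  have h1 := h (-((1 / (A + 1)) • p))
  rw [inner_neg_right, inner_smul_right, real_inner_self_eq_norm_sq, norm_neg, norm_smul,
    Real.norm_of_nonneg (by positivity)] at h1
  have h2 : -(1 / (A + 1) * ‖p‖ ^ 2) + A * (1 / (A + 1) * ‖p‖) ^ 2 = -(‖p‖ / (A + 1)) ^ 2 := by
    field_simp
    ring
  rw [h2] at h1
  have h3 : ‖p‖ / (A + 1) = 0 := by
    have : (‖p‖ / (A + 1)) ^ 2 = 0 := le_antisymm (by linarith) (sq_nonneg _)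
    exact pow_eq_zero_iff (two_ne_zero) |>.1 this
  rcases div_eq_zero_iff.1 h3 with h4 | h4
  · exact norm_eq_zero.1 h4
  · linarith

/-- The maximum of a concave paraboloid over the fibres of the projection is a continuous function
on the torus. -/
theorem exists_periodic_envelope (y p : Space N) (k : ℝ) {A : ℝ} (hA : 0 < A) :
    ∃ S : C(Torus N, ℝ), (∀ z, k + (⟪p, z - y⟫ - A * ‖z - y‖ ^ 2) ≤ S (proj z)) ∧
      ∀ z, ∃ w, proj w = proj z ∧ S (proj z) = k + (⟪p, w - y⟫ - A * ‖w - y‖ ^ 2) := by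
  have hex : ∀ x : Torus N, ∃ w : Space N, proj w = x ∧ ∀ z, proj z = x →
      k + (⟪p, z - y⟫ - A * ‖z - y‖ ^ 2) ≤ k + (⟪p, w - y⟫ - A * ‖w - y‖ ^ 2) := by
    intro x
    obtain ⟨w, hw, hmax⟩ := exists_max_sub_quadratic (0 : C(Torus N, ℝ))
      (isClosed_singleton.preimage continuous_proj : IsClosed (proj ⁻¹' {x}))
      (proj_surjective x) y (-p) hA
    refine ⟨w, hw, fun z hz => ?_⟩
    have := hmax z hz
    simp only [ContinuousMap.zero_apply, inner_neg_left] at this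
    linarith
  choose W hW hWmax using hex
  set S : Torus N → ℝ := fun x => k + (⟪p, W x - y⟫ - A * ‖W x - y‖ ^ 2) with hS
  have hle : ∀ z, k + (⟪p, z - y⟫ - A * ‖z - y‖ ^ 2) ≤ S (proj z) := fun z => hWmax _ z rfl
  -- Continuity comes from semiconvexity: adding `A * ‖z‖²` turns every translate of the paraboloid
  -- along the fibres into an affine function, and a maximum of affine functions is convex.
  have hconv : ConvexOn ℝ Set.univ fun z : Space N => S (proj z) + A * ‖z‖ ^ 2 := by
    refine ⟨convex_univ, fun z₁ _ z₂ _ s t hs ht hst => ?_⟩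
    set z := s • z₁ + t • z₂ with hz
    set h := W (proj z) - z with hh
    have hproj : ∀ z', proj (z' + h) = proj z' := fun z' => by
      rw [proj_add, hh, proj_sub, hW, sub_self, add_zero]
    have haff : ∀ z' : Space N, k + (⟪p, z' + h - y⟫ - A * ‖z' + h - y‖ ^ 2) + A * ‖z'‖ ^ 2 =
        k + ⟪p, h - y⟫ - A * ‖h - y‖ ^ 2 + ⟪p - (2 * A) • (h - y), z'⟫ := by
      intro z'
      rw [add_sub_assoc, norm_add_sq_real, inner_add_right, inner_sub_left, inner_smul_left,
        real_inner_comm z' (h - y)]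
      simp only [conj_trivial]
      ring
    have e0 : S (proj z) + A * ‖z‖ ^ 2 =
        k + ⟪p, h - y⟫ - A * ‖h - y‖ ^ 2 + ⟪p - (2 * A) • (h - y), z⟫ := by
      rw [← haff z]
      have : z + h = W (proj z) := by rw [hh]; abel
      rw [this]
    have e1 := hle (z₁ + h)
    have e2 := hle (z₂ + h)
    rw [hproj] at e1 e2
    have f1 := haff z₁
    have f2 := haff z₂
    have e3 : ⟪p - (2 * A) • (h - y), z⟫ =
        s * ⟪p - (2 * A) • (h - y), z₁⟫ + t * ⟪p - (2 * A) • (h - y), z₂⟫ := by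
      rw [hz, inner_add_right, inner_smul_right, inner_smul_right]
    change S (proj z) + A * ‖z‖ ^ 2 ≤ s • (S (proj z₁) + A * ‖z₁‖ ^ 2) +
      t • (S (proj z₂) + A * ‖z₂‖ ^ 2)
    rw [e0, e3, smul_eq_mul, smul_eq_mul]
    set c := k + ⟪p, h - y⟫ - A * ‖h - y‖ ^ 2
    have g1 : s * (c + ⟪p - (2 * A) • (h - y), z₁⟫) ≤ s * (S (proj z₁) + A * ‖z₁‖ ^ 2) :=
      mul_le_mul_of_nonneg_left (by linarith) hs
    have g2 : t * (c + ⟪p - (2 * A) • (h - y), z₂⟫) ≤ t * (S (proj z₂) + A * ‖z₂‖ ^ 2) :=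
      mul_le_mul_of_nonneg_left (by linarith) ht
    have g3 : c = s * c + t * c := by rw [← add_mul, hst, one_mul]
    linarith
  have hc : Continuous S := by
    rw [isOpenQuotientMap_proj.isQuotientMap.continuous_iff]
    have h1 := continuousOn_univ.1 (hconv.continuousOn isOpen_univ)
    have h2 : Continuous fun z : Space N => (S (proj z) + A * ‖z‖ ^ 2) - A * ‖z‖ ^ 2 :=
      h1.sub (by fun_prop)
    simpa [Function.comp_def] using h2
  exact ⟨⟨S, hc⟩, hle, fun z => ⟨W (proj z), hW _, rfl⟩⟩

/-! ### Perron's method -/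

theorem zerothOrder_update_self (b : Fin m → Fin m → C(Torus N, ℝ)) (l a : ℝ)
    (u : Fin m → C(Torus N, ℝ)) (i : Fin m) (f : C(Torus N, ℝ)) (x : Torus N) :
    zerothOrder b l a (Function.update u i f) i x =
      zerothOrder b l a u i x + (b i i x + l) * (f x - u i x) := by
  have h : ∀ k, b i k x * (Function.update u i f k) x =
      b i k x * u k x + if k = i then b i i x * (f x - u i x) else 0 := by
    intro k
    rcases eq_or_ne k i with rfl | hk
    · simp; ring
    · simp [hk]
  rw [zerothOrder_apply, zerothOrder_apply, Finset.sum_congr rfl fun k _ => h k,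
    Finset.sum_add_distrib, Finset.sum_ite_eq' Finset.univ i]
  simp
  ring

theorem zerothOrder_update_of_ne (b : Fin m → Fin m → C(Torus N, ℝ)) (l a : ℝ)
    (u : Fin m → C(Torus N, ℝ)) {i j : Fin m} (hj : j ≠ i) (f : C(Torus N, ℝ)) (x : Torus N) :
    zerothOrder b l a (Function.update u i f) j x =
      zerothOrder b l a u j x + b j i x * (f x - u i x) := by
  have h : ∀ k, b j k x * (Function.update u i f k) x =
      b j k x * u k x + if k = i then b j i x * (f x - u i x) else 0 := by
    intro k
    rcases eq_or_ne k i with rfl | hk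
    · simp; ring
    · simp [hk]
  rw [zerothOrder_apply, zerothOrder_apply, Finset.sum_congr rfl fun k _ => h k,
    Finset.sum_add_distrib, Finset.sum_ite_eq' Finset.univ i]
  simp [hj]
  ring

/-- A subsolution that is not a supersolution can be increased. -/
theorem SystemSub.exists_lt_of_not_systemSuper {H : Fin m → Torus N → Space N → ℝ}
    (hH : ∀ i, Continuous (Function.uncurry (H i)))
    {b : Fin m → Fin m → C(Torus N, ℝ)} (hb : ∀ i j x, j ≠ i → b i j x ≤ 0) {l a : ℝ}
    (hl : 0 ≤ l) {u : Fin m → C(Torus N, ℝ)} (hu : SystemSub H b l a u)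
    (hns : ¬ SystemSuper H b l a u) : ∃ w, SystemSub H b l a w ∧ u < w := by
  simp only [SystemSuper, quadSuper_def, not_forall, not_le] at hns
  obtain ⟨i, y, p, A, hA, htest, hneg⟩ := hns
  -- With opening `A + 1`, `S` lies below `u i` by at least `‖w - y‖²` at a maximizing lift `w`.
  -- Hence `S + δ` exceeds `u i` only where `‖w - y‖² < δ`.
  obtain ⟨S, hS, hS'⟩ := exists_periodic_envelope y p (u i (proj y)) (A := A + 1) (by positivity)
  -- The third variable accounts for the change in the `i`-th zeroth order term when `u i` is raised
  -- by at most `δ`.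
  have hcont : Continuous fun q : Space N × Space N × ℝ =>
      H i (proj q.1) q.2.1 + zerothOrder b l a u i (proj q.1) + (‖b i i‖ + l) * q.2.2 := by
    have h1 := continuous_proj (N := N)
    have h2 : Continuous fun q : Space N × Space N × ℝ =>
        Function.uncurry (H i) (proj q.1, q.2.1) := (hH i).comp (by fun_prop)
    exact (h2.add (by fun_prop)).add (by fun_prop)
  have hneg' : H i (proj y) p + zerothOrder b l a u i (proj y) + (‖b i i‖ + l) * 0 < 0 := by
    simpa using hneg
  obtain ⟨ε, hε, hball⟩ := Metric.eventually_nhds_iff_ball.1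
    ((hcont.tendsto (y, p, (0 : ℝ))).eventually (gt_mem_nhds hneg'))
  -- Chosen so that the displacement `η` and the gradient displacement `2 * (A + 1) * η` both stay
  -- below `ε`.
  set η := ε / (2 * (A + 1) + 1) with hη
  have hηpos : 0 < η := by positivity
  have hηε : (2 * (A + 1) + 1) * η = ε := by rw [hη]; field_simp
  set δ := min (η ^ 2) (ε / 2) with hδ
  have hδpos : 0 < δ := lt_min (by positivity) (by positivity)
  set f : C(Torus N, ℝ) := u i ⊔ (S + δ • (1 : C(Torus N, ℝ))) with hf
  have hfx : ∀ x, f x = max (u i x) (S x + δ) := fun x => by simp [hf]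
  have hfu : ∀ x, u i x ≤ f x := fun x => by rw [hfx]; exact le_max_left _ _
  refine ⟨Function.update u i f, fun j => ?_, ?_⟩
  · rcases eq_or_ne j i with rfl | hj
    · intro y₁ P A' hA' ht
      simp only [Function.update_self] at ht
      rw [zerothOrder_update_self]
      rcases le_or_gt (S (proj y₁) + δ) (u j (proj y₁)) with hcase | hcase
      · have hval : f (proj y₁) = u j (proj y₁) := by rw [hfx, max_eq_left hcase]
        rw [hval] at ht ⊢
        have := hu j y₁ P A' hA' fun z => (hfu _).trans (ht z)
        simpa using this
      · have hval : f (proj y₁) = S (proj y₁) + δ := by rw [hfx, max_eq_right hcase.le]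
        obtain ⟨w, hw, hSw⟩ := hS' y₁
        have h1 := htest w
        rw [hw] at h1
        have hwδ : ‖w - y‖ ^ 2 < δ := by linarith
        have hwη : ‖w - y‖ < η :=
          lt_of_pow_lt_pow_left₀ 2 hηpos.le (hwδ.trans_le (min_le_left _ _))
        have hfδ : f (proj y₁) - u j (proj y₁) ≤ δ := by
          rw [hval]
          nlinarith [sq_nonneg ‖w - y‖]
        -- At this point `f` is touched from above by the test and from below by the bump's
        -- paraboloid, so the two gradients agree.
        have hP : P = p - (2 * (A + 1)) • (w - y) := by
          rw [← sub_eq_zero]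
          refine eq_zero_of_quadratic_nonneg (A := A' + (A + 1)) (by positivity) fun h => ?_
          have h2 := ht (y₁ + h)
          have h3 : S (proj (y₁ + h)) + δ ≤ f (proj (y₁ + h)) := by
            rw [hfx]; exact le_max_right _ _
          have h4 := hS (w + h)
          rw [proj_add, hw, ← proj_add] at h4
          have h5 := quadratic_recenter (-p) y w (w + h) (A + 1)
          rw [hval, add_sub_cancel_left] at h2
          rw [add_sub_cancel_left] at h5
          simp only [inner_add_left, inner_neg_left, inner_sub_left] at h5 ⊢
          linarith
        have hmem := hball (w, P, δ) (by
          rw [Metric.mem_ball, Prod.dist_eq, Prod.dist_eq, max_lt_iff, max_lt_iff]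
          refine ⟨?_, ?_, ?_⟩
          · rw [dist_eq_norm]
            dsimp only
            nlinarith
          · rw [dist_eq_norm]
            dsimp only
            rw [hP, sub_sub_cancel_left, norm_neg, norm_smul, Real.norm_of_nonneg (by positivity)]
            nlinarith
          · dsimp only
            rw [Real.dist_eq, sub_zero, abs_of_pos hδpos]
            exact (min_le_right _ _).trans_lt (by linarith))
        dsimp only at hmem
        rw [hw] at hmem
        have h6 : (b j j (proj y₁) + l) * (f (proj y₁) - u j (proj y₁)) ≤ (‖b j j‖ + l) * δ := by
          have h7 := (abs_le.1 (le_norm_apply (b j j) (proj y₁))).2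
          refine le_trans (mul_le_mul_of_nonneg_right (add_le_add_left h7 l)
            (sub_nonneg.2 (hfu _))) (mul_le_mul_of_nonneg_left hfδ (by positivity))
        linarith
    -- Raising `u i` only lowers the other equations, by the sign of the off-diagonal entries.
    · intro y₁ P A' hA' ht
      simp only [Function.update_of_ne hj] at ht
      rw [zerothOrder_update_of_ne b l a u hj]
      have h1 := hu j y₁ P A' hA' ht
      have h2 := mul_nonpos_of_nonpos_of_nonneg (hb j i (proj y₁) hj.symm)
        (sub_nonneg.2 (hfu (proj y₁)))
      linarith
  · refine lt_of_le_of_ne ?_ fun heq => ?_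
    · rw [le_update_iff]
      exact ⟨fun x => hfu x, fun _ _ => le_rfl⟩
    · have h1 : f (proj y) = u i (proj y) := by
        conv_rhs => rw [heq]
        simp
      have h2 := hS y
      simp only [sub_self, inner_zero_right, norm_zero] at h2
      have h3 : S (proj y) + δ ≤ f (proj y) := by rw [hfx]; exact le_max_right _ _
      linarith

/-! ### The discounted problem -/

/-- Constants below `-H(x, 0) / l` are subsolutions of the discounted system. -/
theorem systemSub_const {H : Fin m → Torus N → Space N → ℝ}
    {b : Fin m → Fin m → C(Torus N, ℝ)} (hb : DegenerateCoupling b) {l k : ℝ}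
    (hk : ∀ i x, H i x 0 + l * k ≤ 0) : SystemSub H b l 0 fun _ => ContinuousMap.const _ k := by
  intro i y p A hA ht
  have hp : p = 0 := eq_zero_of_quadratic_nonneg hA fun z => by
    have := ht (y + z)
    simp only [ContinuousMap.const_apply, add_sub_cancel_left] at this
    linarith
  rw [hp, zerothOrder_apply]
  simp only [ContinuousMap.const_apply, ← Finset.sum_mul, hb.row_sum, zero_mul, zero_add, sub_zero]
  exact hk i _

/-- Upper bound for the subsolutions of the discounted system. -/
theorem SystemSub.mul_le {H : Fin m → Torus N → Space N → ℝ}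
    {b : Fin m → Fin m → C(Torus N, ℝ)} (hb : DegenerateCoupling b) {l C : ℝ} (hl : 0 ≤ l)
    (hC : ∀ i x, -C ≤ H i x 0) {u : Fin m → C(Torus N, ℝ)} (hu : SystemSub H b l 0 u)
    (i : Fin m) (x : Torus N) : l * u i x ≤ C := by
  obtain ⟨⟨j, z⟩, -, hmax⟩ := (isCompact_univ (X := Fin m × Torus N)).exists_isMaxOn
    ⟨(i, x), trivial⟩ (f := fun q => u q.1 q.2)
    (continuous_prod_of_discrete_left.2 fun i => (u i).continuous).continuousOn
  have hmax : ∀ j' x', u j' x' ≤ u j z := fun j' x' => hmax (Set.mem_univ (j', x'))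
  obtain ⟨y, rfl⟩ := proj_surjective z
  have h1 := hu j y 0 0 le_rfl fun z' => by simpa using hmax j (proj z')
  rw [zerothOrder_apply] at h1
  have h2 := hb.sum_nonneg_of_max (f := fun j => u j (proj y)) (fun j' => hmax j' _) (proj y)
  have h3 := hC j (proj y)
  have h4 := mul_le_mul_of_nonneg_left (hmax i x) hl
  linarith

/-- The discounted system has a bounded solution. -/
theorem exists_discounted_solution {H : Fin m → Torus N → Space N → ℝ}
    (hH : ∀ i, Continuous (Function.uncurry (H i))) (hcoer : UniformlyCoercive H)
    {b : Fin m → Fin m → C(Torus N, ℝ)} (hb : DegenerateCoupling b) {l C : ℝ} (hl : 0 < l)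
    (hC0 : 0 ≤ C) (hC : ∀ i x, |H i x 0| ≤ C) :
    ∃ u, SystemSub H b l 0 u ∧ SystemSuper H b l 0 u ∧ ∀ i x, |l * u i x| ≤ C := by
  have hupper : ∀ u, SystemSub H b l 0 u → ∀ i x, l * u i x ≤ C := fun u hu =>
    hu.mul_le hb hl.le fun i x => (abs_le.1 (hC i x)).1
  -- The lower bound survives any increase, so a maximal element of `G` is maximal among all
  -- subsolutions; the matching upper bound is automatic.
  set G : Set (Fin m → C(Torus N, ℝ)) := {u | SystemSub H b l 0 u ∧ ∀ i x, -C ≤ l * u i x} with hG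
  have habs : ∀ u ∈ G, ∀ i x, |l * u i x| ≤ C := fun u hu i x =>
    abs_le.2 ⟨hu.2 i x, hupper u hu.1 i x⟩
  have heval : ∀ (i : Fin m) (x : Torus N), Continuous fun u : Fin m → C(Torus N, ℝ) => u i x :=
    fun i x => (continuous_eval_const x).comp (continuous_apply i)
  have hGcl : IsClosed G := by
    have h1 : IsClosed {u : Fin m → C(Torus N, ℝ) | ∀ i x, -C ≤ l * u i x} := by
      simp only [Set.ofPred_forall]
      exact isClosed_iInter fun i => isClosed_iInter fun x =>
        isClosed_le continuous_const (continuous_const.mul (heval i x))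
    exact ((isClosed_systemSub hH b).preimage
      (f := fun u : Fin m → C(Torus N, ℝ) => (l, (0 : ℝ), u)) (by fun_prop)).inter h1
  have hGcomp : IsCompact G := by
    refine ((isCompact_bounded_subsolutions hH hcoer b l 0 (R := C / l) (by positivity)).image
      (continuous_snd.comp continuous_snd)).of_isClosed_subset hGcl fun u hu => ?_
    refine ⟨(l, 0, u), ⟨⟨hl.le, le_rfl⟩, by simp, fun i => ?_, hu.1⟩, rfl⟩
    refine (ContinuousMap.norm_le _ (by positivity)).2 fun x => ?_
    rw [le_div_iff₀ hl, Real.norm_eq_abs, mul_comm]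
    simpa [abs_mul, abs_of_pos hl] using habs u hu i x
  have hGne : G.Nonempty := by
    have e : l * (-C / l) = -C := by field_simp
    refine ⟨fun _ => ContinuousMap.const _ (-C / l), systemSub_const hb fun i x => ?_,
      fun i x => ?_⟩
    · rw [e]
      linarith [(abs_le.1 (hC i x)).2]
    · rw [ContinuousMap.const_apply, e]
  have hIci : ∀ v : Fin m → C(Torus N, ℝ), IsClosed (Set.Ici v) := fun v => by
    have : Set.Ici v = {w | ∀ i x, v i x ≤ w i x} := rfl
    rw [this]
    simp only [Set.ofPred_forall]
    exact isClosed_iInter fun i => isClosed_iInter fun x =>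
      isClosed_le continuous_const (heval i x)
  obtain ⟨u, hu⟩ := exists_maximal_of_isCompact hIci hGcomp hGne
  have huG : u ∈ G := hu.prop
  refine ⟨u, huG.1, ?_, habs u huG⟩
  by_contra hns
  obtain ⟨w, hw, huw⟩ := huG.1.exists_lt_of_not_systemSuper hH hb.off_diag_nonpos hl.le hns
  refine hu.not_prop_of_gt huw ⟨hw, fun i x => (huG.2 i x).trans ?_⟩
  exact mul_le_mul_of_nonneg_left (huw.le i x) hl.le

/-- The oscillation of the discounted solutions is bounded uniformly with respect to the
discount. -/
theorem exists_discounted_oscillation_bound {H : Fin m → Torus N → Space N → ℝ}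
    (hcoer : UniformlyCoercive H) {b : Fin m → Fin m → C(Torus N, ℝ)} (hb : DegenerateCoupling b)
    {C h : ℝ} (hC0 : 0 ≤ C) (hh0 : 0 ≤ h) (hh : ∀ i x p, -h ≤ H i x p) :
    ∃ R : ℝ, 0 ≤ R ∧ ∀ (l : ℝ) (u : Fin m → C(Torus N, ℝ)), SystemSub H b l 0 u →
      (∀ i x, |l * u i x| ≤ C) → ∀ i k x x', |u i x - u k x'| ≤ R := by
  -- Since `H ≥ -h`, the zeroth order term is at most `h`; removing `l * u i`, of size at most `C`,
  -- bounds the coupling terms by `h + C`.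
  obtain ⟨R₁, hR₁, hosc⟩ := hb.exists_oscillation_bound (C := h + C) (by positivity)
  obtain ⟨K, hK, hlip⟩ := hcoer.exists_lipschitz ((∑ i, ∑ j, ‖b i j‖) * R₁ + C)
  obtain ⟨R₀, hR₀, hlift⟩ := exists_bounded_lift N
  refine ⟨R₁ + K * (2 * R₀), by positivity, fun l u hu hlu => ?_⟩
  have hzo : ∀ i x, zerothOrder b l 0 u i x ≤ h := fun i =>
    le_of_le_at_quadratic_tests (u i) _ fun y p A hA ht => by
      linarith [hu i y p A hA ht, hh i (proj y) p]
  have hcomp : ∀ x i k, u i x - u k x ≤ R₁ := fun x => by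
    refine hosc x (fun i => u i x) fun i => ?_
    have h1 := hzo i x
    rw [zerothOrder_apply] at h1
    linarith [(abs_le.1 (hlu i x)).1]
  have hlow : ∀ i x, -((∑ i, ∑ j, ‖b i j‖) * R₁ + C) ≤ zerothOrder b l 0 u i x := by
    intro i x
    -- Only differences of components enter after this rewriting. They are bounded uniformly in `l`,
    -- unlike `u` itself.
    rw [zerothOrder_apply, ← hb.sum_mul_sub_const i x (fun j => u j x) (u i x)]
    have e1 : |∑ j, b i j x * (u j x - u i x)| ≤ (∑ i, ∑ j, ‖b i j‖) * R₁ := by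
      calc |∑ j, b i j x * (u j x - u i x)| ≤ ∑ j, |b i j x * (u j x - u i x)| :=
            Finset.abs_sum_le_sum_abs _ _
        _ ≤ ∑ j, ‖b i j‖ * R₁ := by
          refine Finset.sum_le_sum fun j _ => ?_
          rw [abs_mul]
          refine mul_le_mul (le_norm_apply _ x) ?_ (abs_nonneg _) (norm_nonneg _)
          exact abs_le.2 ⟨by linarith [hcomp x i j], hcomp x j i⟩
        _ = (∑ j, ‖b i j‖) * R₁ := by rw [Finset.sum_mul]
        _ ≤ _ := by
          refine mul_le_mul_of_nonneg_right ?_ hR₁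
          exact Finset.single_le_sum (f := fun i => ∑ j, ‖b i j‖)
            (fun i _ => Finset.sum_nonneg fun j _ => norm_nonneg _) (Finset.mem_univ i)
    linarith [(abs_le.1 e1).1, (abs_le.1 (hlu i x)).1]
  have hone : ∀ i k x x', u i x - u k x' ≤ R₁ + K * (2 * R₀) := by
    intro i k x x'
    obtain ⟨y, rfl, hy⟩ := hlift x
    obtain ⟨y', rfl, hy'⟩ := hlift x'
    have h1 := hlip b l 0 u hu hlow i y' y
    have h2 := hcomp (proj y') i k
    have h3 : K * ‖y - y'‖ ≤ K * (2 * R₀) :=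
      mul_le_mul_of_nonneg_left ((norm_sub_le _ _).trans (by linarith)) hK
    linarith
  exact fun i k x x' => abs_le.2 ⟨by linarith [hone k i x' x], hone i k x x'⟩

/-! ### The ergodic problem -/

theorem QuadSub.sub_const {H : Torus N → Space N → ℝ} {u g : C(Torus N, ℝ)} (h : QuadSub H u g)
    (k : ℝ) : QuadSub H (u - ContinuousMap.const _ k) g := fun y p A hA ht =>
  h y p A hA fun z => by
    have := ht z
    simp only [ContinuousMap.sub_apply, ContinuousMap.const_apply] at this
    linarith

theorem QuadSuper.sub_const {H : Torus N → Space N → ℝ} {u g : C(Torus N, ℝ)}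
    (h : QuadSuper H u g) (k : ℝ) : QuadSuper H (u - ContinuousMap.const _ k) g :=
  quadSuper_def.2 fun y p A hA ht => quadSuper_def.1 h y p A hA fun z => by
    have := ht z
    simp only [ContinuousMap.sub_apply, ContinuousMap.const_apply] at this
    linarith

/-- Constants lie in the kernel of the coupling, so subtracting one only transfers its discount to
the right-hand side. -/
theorem zerothOrder_sub_const {b : Fin m → Fin m → C(Torus N, ℝ)} (hb : DegenerateCoupling b)
    (l a k : ℝ) (u : Fin m → C(Torus N, ℝ)) (i : Fin m) :
    zerothOrder b l (a - l * k) (fun j => u j - ContinuousMap.const _ k) i =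
      zerothOrder b l a u i := by
  ext x
  rw [zerothOrder_apply, zerothOrder_apply]
  have := hb.sum_mul_sub_const i x (fun j => u j x) k
  simp only [ContinuousMap.sub_apply, ContinuousMap.const_apply]
  rw [this]
  ring

/-- Coercivity confines the nonpositive values of `H` to a compact set of momenta, where continuity
bounds them. -/
theorem UniformlyCoercive.exists_lower_bound {H : Fin m → Torus N → Space N → ℝ}
    (hH : ∀ i, Continuous (Function.uncurry (H i))) (hcoer : UniformlyCoercive H) :
    ∃ h : ℝ, 0 ≤ h ∧ ∀ i x p, -h ≤ H i x p := by
  obtain ⟨K, hK, hKp⟩ := hcoer 0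
  have hc : Continuous fun q : Fin m × Torus N × Space N => H q.1 q.2.1 q.2.2 :=
    continuous_prod_of_discrete_left.2 fun i => hH i
  obtain ⟨h, hh⟩ := ((isCompact_univ (X := Fin m)).prod ((isCompact_univ (X := Torus N)).prod
    (isCompact_closedBall (0 : Space N) K))).exists_bound_of_continuousOn hc.continuousOn
  refine ⟨max h 0, le_max_right _ _, fun i x p => ?_⟩
  rcases le_or_gt (H i x p) 0 with hle | hgt
  · have h1 := hh (i, x, p) ⟨trivial, trivial, by simpa using hKp i x p hle⟩
    rw [Real.norm_eq_abs] at h1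
    linarith [(abs_le.1 h1).1, le_max_left h 0]
  · linarith [le_max_right h 0]

theorem exists_bound_at_zero {H : Fin m → Torus N → Space N → ℝ}
    (hH : ∀ i, Continuous (Function.uncurry (H i))) :
    ∃ C : ℝ, 0 ≤ C ∧ ∀ i x, |H i x 0| ≤ C := by
  have hc : Continuous fun q : Fin m × Torus N => H q.1 q.2 0 :=
    continuous_prod_of_discrete_left.2 fun i =>
      (hH i).comp (continuous_id.prodMk (continuous_const (y := (0 : Space N))))
  obtain ⟨C, hC⟩ := (isCompact_univ (X := Fin m × Torus N)).exists_bound_of_continuousOn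
    hc.continuousOn
  exact ⟨max C 0, le_max_right _ _, fun i x => (hC (i, x) trivial).trans (le_max_left _ _)⟩

/-- For some right-hand side the system without discount has a solution. -/
theorem exists_ergodic_solution (hm : 0 < m) {H : Fin m → Torus N → Space N → ℝ}
    (hH : ∀ i, Continuous (Function.uncurry (H i))) (hcoer : UniformlyCoercive H)
    {b : Fin m → Fin m → C(Torus N, ℝ)} (hb : DegenerateCoupling b) :
    ∃ a u, SystemSub H b 0 a u ∧ SystemSuper H b 0 a u := by
  obtain ⟨C, hC0, hC⟩ := exists_bound_at_zero hH
  obtain ⟨h, hh0, hh⟩ := hcoer.exists_lower_bound hH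
  obtain ⟨R, hR, hosc⟩ := exists_discounted_oscillation_bound hcoer hb hC0 hh0 hh
  have hex : ∀ n : ℕ, ∃ q : ℝ × (Fin m → C(Torus N, ℝ)), |q.1| ≤ C ∧ (∀ i, ‖q.2 i‖ ≤ R) ∧
      SystemSub H b (1 / ((n : ℝ) + 1)) q.1 q.2 ∧ SystemSuper H b (1 / ((n : ℝ) + 1)) q.1 q.2 := by
    intro n
    obtain ⟨u, hu, hu', hbd⟩ := exists_discounted_solution hH hcoer hb
      (l := 1 / ((n : ℝ) + 1)) (by positivity) hC0 hC
    set l := 1 / ((n : ℝ) + 1)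
    set k := u ⟨0, hm⟩ 0
    -- Normalization at one component and one point: the oscillation bound becomes a norm bound, and
    -- the new right-hand side `-l * k` stays in `[-C, C]`.
    refine ⟨(0 - l * k, fun j => u j - ContinuousMap.const _ k), ?_, fun i => ?_, fun i => ?_,
      fun i => ?_⟩
    · rw [zero_sub, abs_neg]
      exact hbd _ _
    · exact (ContinuousMap.norm_le _ hR).2 fun x => hosc l u hu hbd i _ x _
    · rw [zerothOrder_sub_const hb]
      exact (hu i).sub_const k
    · rw [zerothOrder_sub_const hb]
      exact (hu' i).sub_const k
  choose q hqa hqR hsub hsup using hex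
  obtain ⟨⟨l, a, u⟩, -, φ, hφ, hlim⟩ :=
    (isCompact_bounded_subsolutions hH hcoer b 1 C hR).tendsto_subseq (x := fun n : ℕ => (1 / ((n : ℝ) + 1), q n)) fun n =>
      ⟨⟨by positivity, (div_le_one (by positivity)).2 (by simp)⟩, abs_le.1 (hqa n), hqR n, hsub n⟩
  have hl : l = 0 := by
    have h1 : Tendsto (fun n => 1 / ((φ n : ℝ) + 1)) atTop (𝓝 l) :=
      (continuous_fst.tendsto _).comp hlim
    exact tendsto_nhds_unique h1
      (tendsto_one_div_add_atTop_nhds_zero_nat.comp hφ.tendsto_atTop)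
  subst hl
  exact ⟨a, u, (isClosed_systemSub hH b).mem_of_tendsto hlim (Eventually.of_forall fun n => hsub _),
    (isClosed_systemSuper hH b).mem_of_tendsto hlim (Eventually.of_forall fun n => hsup _)⟩

/-! ### Translation to the statement -/

theorem uniformlyCoercive_of_isConvexHamiltonian {H : Fin m → Torus N → Space N → ℝ}
    (hH : ∀ i, IsConvexHamiltonian (H i)) : UniformlyCoercive H := by
  intro C
  have hone : ∀ i, ∃ K : ℝ, 0 ≤ K ∧ ∀ x p, H i x p ≤ C → ‖p‖ ≤ K := by
    intro i
    obtain ⟨α, β, hα, -, hαβ⟩ := (hH i).coercive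
    obtain ⟨K, hK⟩ := eventually_atTop.1 (hα.eventually_gt_atTop C)
    refine ⟨K, K.2, fun x p hp => ?_⟩
    by_contra hcon
    have h1 : K ≤ ‖p‖₊ := (not_le.1 hcon).le
    linarith [hK _ h1, (hαβ x p).1]
  choose K hK hKp using hone
  refine ⟨∑ i, K i, Finset.sum_nonneg fun i _ => hK i, fun i x p hp => (hKp i x p hp).trans ?_⟩
  exact Finset.single_le_sum (fun i _ => hK i) (Finset.mem_univ i)

/-- The entries of a continuous matrix, as continuous functions. -/
def couplingEntries (B : Torus N → Matrix (Fin m) (Fin m) ℝ) (hB : Continuous B) :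
    Fin m → Fin m → C(Torus N, ℝ) :=
  fun i j => ⟨fun x => B x i j, hB.matrix_elem i j⟩

theorem isSubsolution_iff {H : Fin m → Torus N → Space N → ℝ}
    (hH : ∀ i, Continuous (Function.uncurry (H i))) {B : Torus N → Matrix (Fin m) (Fin m) ℝ}
    (hB : Continuous B) (a : ℝ) (u : Fin m → C(Torus N, ℝ)) :
    IsSubsolution H B (fun _ => a) u ↔ SystemSub H (couplingEntries B hB) 0 a u := by
  simp only [IsSubsolution, SystemSub, quadSub_iff (hH _), zerothOrder_apply, couplingTerm,
    couplingEntries, ContinuousMap.coe_mk, zero_mul, add_zero, ← add_sub_assoc, sub_nonpos]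
  exact forall_comm

theorem isSupersolution_iff {H : Fin m → Torus N → Space N → ℝ}
    (hH : ∀ i, Continuous (Function.uncurry (H i))) {B : Torus N → Matrix (Fin m) (Fin m) ℝ}
    (hB : Continuous B) (a : ℝ) (u : Fin m → C(Torus N, ℝ)) :
    IsSupersolution H B (fun _ => a) u ↔ SystemSuper H (couplingEntries B hB) 0 a u := by
  simp only [IsSupersolution, SystemSuper, quadSuper_iff (hH _), zerothOrder_apply, couplingTerm,
    couplingEntries, ContinuousMap.coe_mk, zero_mul, add_zero, ← add_sub_assoc, sub_nonneg]
  exact forall_comm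

end WeakKAM

theorem mainTheorem6 {N m : ℕ} (hm : 1 ≤ m)
    (H : Fin m → WeakKAM.Torus N → WeakKAM.Space N → ℝ)
    (hH : ∀ i, WeakKAM.IsConvexHamiltonian (H i))
    (B : WeakKAM.Torus N → Matrix (Fin m) (Fin m) ℝ)
    (hB_cont : Continuous B)
    (hB_coupling : ∀ x, WeakKAM.IsCoupling (B x))
    (hB_irred : ∀ x, WeakKAM.IsIrreducible (B x))
    (hB_deg : ∀ x, WeakKAM.IsDegenerate (B x)) :
    IsLeast {a : ℝ | (WeakKAM.subsolutions H B a).Nonempty} (WeakKAM.criticalValue H B) ∧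
    (∃ u ∈ WeakKAM.subsolutions H B (WeakKAM.criticalValue H B),
      WeakKAM.IsSolution H B (fun _ => WeakKAM.criticalValue H B) u) ∧
    (∀ a : ℝ, (∃ u : Fin m → C(WeakKAM.Torus N, ℝ), WeakKAM.IsSolution H B (fun _ => a) u) ↔
      a = WeakKAM.criticalValue H B) := by
  have hHc : ∀ i, Continuous (Function.uncurry (H i)) := fun i => (hH i).continuous
  have hcoer := WeakKAM.uniformlyCoercive_of_isConvexHamiltonian hH
  have hb : WeakKAM.DegenerateCoupling (WeakKAM.couplingEntries B hB_cont) :=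
    ⟨fun i j x hij => (hB_coupling x).off_diag_nonpos i j hij, fun i x => hB_deg x i,
      fun x => hB_irred x⟩
  have hcomp : ∀ (a a' : ℝ) (v u : Fin m → C(WeakKAM.Torus N, ℝ)),
      WeakKAM.IsSubsolution H B (fun _ => a) v →
      WeakKAM.IsSupersolution H B (fun _ => a') u → a' ≤ a := fun a a' v u hv hu =>
    ((WeakKAM.isSubsolution_iff hHc hB_cont a v).1 hv).le_of_systemSuper hm hHc hcoer hb
      ((WeakKAM.isSupersolution_iff hHc hB_cont a' u).1 hu)
  obtain ⟨c, u, hu, hu'⟩ := WeakKAM.exists_ergodic_solution hm hHc hcoer hb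
  have hsol : WeakKAM.IsSolution H B (fun _ => c) u :=
    ⟨(WeakKAM.isSubsolution_iff hHc hB_cont c u).2 hu,
      (WeakKAM.isSupersolution_iff hHc hB_cont c u).2 hu'⟩
  have hleast : IsLeast {a : ℝ | (WeakKAM.subsolutions H B a).Nonempty} c :=
    ⟨⟨u, hsol.1⟩, fun a ⟨v, hv⟩ => hcomp a c v u hv hsol.2⟩
  have hc : WeakKAM.criticalValue H B = c := hleast.csInf_eq
  rw [hc]
  refine ⟨hleast, ⟨u, hsol.1, hsol⟩, fun a => ⟨fun ⟨v, hv⟩ => ?_, fun h => h ▸ ⟨u, hsol⟩⟩⟩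
  exact le_antisymm (hcomp c a u v hsol.1 hv.2) (hcomp a c v u hv.1 hsol.2)
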